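/- Let $n\ge 1$ and let $L=\log(I-\Delta)$ be the self-adjoint operator on $L^2(\mathbf R^n)$ with Fourier symbol $\log(1+|\xi|^2)$ (kernel $e^{-ix\cdot\xi}$), i.e. $D(L)=\{f\in L^2:\ \log(1+|\xi|^2)\hat f\in L^2\}$ and $\widehat{Lf}(\xi)=\log(1+|\xi|^2)\hat f(\xi)$; let $L^{1/2}$ be its nonnegative square root. Consider the Cauchy problem $$u_{tt}+Lu+Lu_t=0\ \ (t>0,\ x\in\mathbf R^n),\qquad u(0,x)=0,\quad u_t(0,x)=u_1(x).$$ A mild solution is a function $u\in C([0,\infty);D(L^{1/2}))\cap C^1([0,\infty);L^2(\mathbf R^n))$ with $u(0)=0$ and $u_t(0)=u_1$ such that, for all $t\ge 0$, $\int_0^t u(s)\,ds+u(t)\in D(L)$ and $u_t(t)=u_1-L\big(\int_0^t u(s)\,ds+u(t)\big)$. For $u_1\in L^2(\mathbf R^n)$ with $\int(1+|x|)|u_1(x)|\,dx<\infty$ put $$P_1=\int_{\mathbf R^n}u_1(x)\,dx,\qquad I_0=\|u_1\|_{L^2}+\|(1+|x|)u_1\|_{L^1},$$ and let $g_1(t)=\sqrt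 t$, $g_2(t)=\sqrt{\log t}$, and $g_n(t)=t^{-(n-2)/4}$ for $n\ge 3$. Theorem. There are constants $C_n>0$ and $T_n$, depending only on $n$, such that for every $u_1\in L^2(\mathbf R^n)$ with $\int(1+|x|)|u_1(x)|\,dx<\infty$ the problem has a unique mild solution $u$, and $$\|u(t,\cdot)\|_{L^2}\le C_n^{-1}I_0\,g_n(t)\quad\text{for all } t\ge T_n,$$ and there is $T$ (which may depend on $u_1$) such that $$C_n|P_1|\,g_n(t)\le\|u(t,\cdot)\|_{L^2}\quad\text{for all } t\ge T.$$ -/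

import Mathlib

namespace LogWave

noncomputable section

open MeasureTheory Set

/-- Euclidean space `ℝⁿ`. -/
abbrev Space (n : ℕ) : Type := EuclideanSpace ℝ (Fin n)

/-- The complex Hilbert space `L²(ℝⁿ)` with Lebesgue measure. -/
abbrev L2 (n : ℕ) : Type := Lp (α := Space n) ℂ 2 volume

/-- Mathlib's unitary Fourier transform on `L²(ℝⁿ)`, the extension of
`f ↦ ∫ exp(-2πi x·ξ) f(x) dx`. -/
abbrev fourierL2 (n : ℕ) : L2 n ≃ₗᵢ[ℂ] L2 n := Lp.fourierTransformₗᵢ (Space n) ℂ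

/-- The domain `{f ∈ L² | m · 𝓕 f ∈ L²}` of the Fourier multiplier with symbol `m`. -/
def multiplierDomain {n : ℕ} (m : Space n → ℝ) : Submodule ℂ (L2 n) where
  carrier := {f | MemLp (fun ξ => (m ξ : ℂ) * fourierL2 n f ξ) 2 volume}
  add_mem' := by
    intro f g hf hg
    refine (MemLp.add hf hg).ae_eq ?_
    rw [map_add]
    filter_upwards [Lp.coeFn_add (fourierL2 n f) (fourierL2 n g)] with ξ hξ
    rw [hξ, Pi.add_apply, Pi.add_apply, mul_add]
  zero_mem' := by
    refine (MemLp.zero (ε := ℂ) (p := 2) (μ := (volume : Measure (Space n)))).ae_eq ?_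
    rw [map_zero]
    filter_upwards [Lp.coeFn_zero ℂ 2 (volume : Measure (Space n))] with ξ hξ
    rw [hξ, Pi.zero_apply, mul_zero]
  smul_mem' := by
    intro c f hf
    refine (MemLp.const_smul hf c).ae_eq ?_
    rw [map_smul]
    filter_upwards [Lp.coeFn_smul c (fourierL2 n f)] with ξ hξ
    rw [hξ, Pi.smul_apply, Pi.smul_apply, smul_eq_mul, smul_eq_mul, mul_left_comm]

theorem memLp_of_mem {n : ℕ} {m : Space n → ℝ} {f : L2 n} (hf : f ∈ multiplierDomain m) :
    MemLp (fun ξ => (m ξ : ℂ) * fourierL2 n f ξ) 2 volume := hf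

/-- `f ↦ m · 𝓕 f` on the domain of the Fourier multiplier with symbol `m`. -/
def symbolMul {n : ℕ} (m : Space n → ℝ) : multiplierDomain m →ₗ[ℂ] L2 n where
  toFun f := MemLp.toLp (fun ξ => (m ξ : ℂ) * fourierL2 n f.1 ξ) (memLp_of_mem f.2)
  map_add' := by
    intro f g
    rw [← MemLp.toLp_add]
    apply MemLp.toLp_congr
    rw [Submodule.coe_add, map_add]
    filter_upwards [Lp.coeFn_add (fourierL2 n f.1) (fourierL2 n g.1)] with ξ hξ
    rw [hξ, Pi.add_apply, Pi.add_apply, mul_add]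
  map_smul' := by
    intro c f
    rw [RingHom.id_apply, ← MemLp.toLp_const_smul]
    apply MemLp.toLp_congr
    rw [Submodule.coe_smul, map_smul]
    filter_upwards [Lp.coeFn_smul c (fourierL2 n f.1)] with ξ hξ
    rw [hξ, Pi.smul_apply, Pi.smul_apply, smul_eq_mul, smul_eq_mul, mul_left_comm]

/-- The (possibly unbounded) Fourier multiplier `f ↦ 𝓕⁻¹ (m · 𝓕 f)` on `L²(ℝⁿ)`, with domain
`{f ∈ L² | m · 𝓕 f ∈ L²}`. -/
def fourierMultiplier {n : ℕ} (m : Space n → ℝ) : L2 n →ₗ.[ℂ] L2 n where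
  domain := multiplierDomain m
  toFun := (fourierL2 n).symm.toLinearEquiv.toLinearMap ∘ₗ symbolMul m

/-- The symbol of `log(I - Δ)`. With the kernel `exp(-2πi x·ξ)` the operator `-Δ` has symbol
`|2πξ|²`, so that the symbol `log(1 + |ξ|²)` for the kernel `exp(-i x·ξ)` becomes
`log(1 + |2πξ|²)`. -/
def logSymbol {n : ℕ} (ξ : Space n) : ℝ := Real.log (1 + (2 * Real.pi * ‖ξ‖) ^ 2)

/-- The operator `L = log(I - Δ)` on `L²(ℝⁿ)`. -/
def opL (n : ℕ) : L2 n →ₗ.[ℂ] L2 n := fourierMultiplier logSymbol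

/-- The square root `L^{1/2}` of `L = log(I - Δ)`. -/
def opLSqrt (n : ℕ) : L2 n →ₗ.[ℂ] L2 n := fourierMultiplier fun ξ => Real.sqrt (logSymbol ξ)

/-- `u` is a mild solution on `[0, ∞)` of `u_tt + L u + L u_t = 0`, `u(0) = u₀`, `u_t(0) = u₁`:

* `u ∈ C¹([0, ∞); L²)` with derivative `v = u_t`, and `u ∈ C([0, ∞); D(L^{1/2}))` (graph norm),
  where `w = L^{1/2} u`;
* `U = (u, v)` satisfies `∫₀ᵗ U ∈ D(A)` and `U(t) = U(0) + A ∫₀ᵗ U(s) ds` for all `t ≥ 0`, where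
  `A (f, g) = (g, -L (f + g))`, with domain `{(f, g) | f, g ∈ D(L^{1/2}), f + g ∈ D(L)}`, is the
  generator of the equation on `D(L^{1/2}) × L²`. As `∫₀ᵗ v = u(t) - u₀`, this says that
  `∫₀ᵗ u + u(t) - u₀ ∈ D(L)` and `L (∫₀ᵗ u + u(t) - u₀) = u₁ - v(t)`.

Only the values of `u` on `[0, ∞)` matter. -/
def IsMildSolution {n : ℕ} (u₀ u₁ : L2 n) (u : ℝ → L2 n) : Prop :=
  ∃ v w : ℝ → L2 n,
    (∀ t, 0 ≤ t → HasDerivWithinAt u (v t) (Ici 0) t) ∧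
    ContinuousOn v (Ici 0) ∧
    (∀ t, 0 ≤ t → (u t, w t) ∈ (opLSqrt n).graph) ∧
    ContinuousOn w (Ici 0) ∧
    u 0 = u₀ ∧ v 0 = u₁ ∧
    ∀ t, 0 ≤ t → ((∫ s in (0 : ℝ)..t, u s) + u t - u₀, u₁ - v t) ∈ (opL n).graph

/-- `f ∈ L^{1,1}(ℝⁿ)`: `f ∈ L¹` and `∫ (1 + |x|) |f(x)| dx < ∞`. -/
def MemL11 {n : ℕ} (f : Space n → ℂ) : Prop :=
  Integrable f volume ∧ Integrable (fun x => (1 + ‖x‖) * ‖f x‖) volume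

/-- `I₀ = ‖u₁‖_{L²} + ‖(1 + |x|) u₁‖_{L¹}`. -/
def I0 {n : ℕ} (u₁ : L2 n) : ℝ := ‖u₁‖ + ∫ x, (1 + ‖x‖) * ‖u₁ x‖

/-- `P₁ = ∫ u₁(x) dx`. -/
def P1 {n : ℕ} (u₁ : L2 n) : ℂ := ∫ x, u₁ x

/-- The rate `g_n(t)`: `√t` for `n = 1`, `√(log t)` for `n = 2`, `t^{-(n-2)/4}` for `n ≥ 3`. -/
def rate (n : ℕ) (t : ℝ) : ℝ :=
  if n = 1 then Real.sqrt t
  else if n = 2 then Real.sqrt (Real.log t)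
  else t ^ (-((n : ℝ) - 2) / 4)

end

end LogWave

namespace LogWave

noncomputable section

open MeasureTheory Set Filter Topology
open scoped FourierTransform SchwartzMap ContDiff

/-! On the Fourier side the equation decouples: `û(t,ξ) = k(a,t) û₁(ξ)` with `a = log(1+|2πξ|²)`,
where `k = waveKernel` solves `y'' + a y' + a y = 0`, `y(0) = 0`, `y'(0) = 1`. The energy `k'² + a
k²` never exceeds 1, so `k'`, `√a k` and, for bounded time, `k` are bounded uniformly in `a`;
dominated convergence then makes this multiplier a mild solution (`isMildSolution_waveSol`).
Uniqueness follows by cutting off high frequencies, which turns the integrated equation into a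
Lipschitz ODE (`IsMildSolution.unique`).

By Plancherel, `‖u(t)‖² = ∫ k² |û₁|²`. Away from `ξ = 0` the kernel decays exponentially
(`abs_waveKernel_le_exp`). Near `0`, with `s = 2π|ξ|`, one has `a ≈ s²` and `k² ≈ exp(-s²t)
sin²(st)/s²`, so everything reduces to the size of `∫ k² r^(n-1) dr`. For `n = 1` the zone `r ≲
1/t`, where `k² ~ t²`, contributes order `t`; for `n = 2` the range `1/t < r < t^(-1/2)` contributes
`∫ dr/r ~ log t`; for `n ≥ 3` the scale `r ~ t^(-1/2)` of the Gaussian gives `t^(-(n-2)/2)`. These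
are the squares of the rates (`exists_radial_upper`, `exists_radial_lower`).

The upper bound uses `|û₁| ≤ ‖u₁‖_{L¹}`. The lower bound uses that `û₁` is continuous with `û₁(0) =
P₁`, so that `|û₁| ≥ |P₁|/2` on a small ball, which eventually contains the dominant frequencies. -/

/-- Multiplication of an `L²` function by the real function `m`; it is zero if the product is not
in `L²`. -/
def mulLp {n : ℕ} (m : Space n → ℝ) (f : L2 n) : L2 n :=
  open Classical in
  if h : MemLp (fun ξ => (m ξ : ℂ) * f ξ) 2 volume then h.toLp else 0

/-! ### Multiplication operators on `L²`: continuity and differentiability in a parameter. -/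

section Multiplication

variable {n : ℕ}

theorem memLp_mul_of_bounded {m : Space n → ℝ} {M : ℝ} (hm : Measurable m)
    (hM : ∀ ξ, |m ξ| ≤ M) (f : L2 n) : MemLp (fun ξ => (m ξ : ℂ) * f ξ) 2 volume := by
  refine MemLp.of_le_mul (c := M) (Lp.memLp f) ?_ (Eventually.of_forall fun ξ => ?_)
  · exact (Complex.measurable_ofReal.comp hm).aestronglyMeasurable.mul (Lp.aestronglyMeasurable f)
  · rw [norm_mul, Complex.norm_real, Real.norm_eq_abs]
    exact mul_le_mul_of_nonneg_right (hM ξ) (norm_nonneg _)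

theorem coeFn_mulLp_of_memLp {m : Space n → ℝ} {f : L2 n}
    (h : MemLp (fun ξ => (m ξ : ℂ) * f ξ) 2 volume) :
    mulLp m f =ᵐ[volume] fun ξ => (m ξ : ℂ) * f ξ := by
  rw [mulLp, dif_pos h]
  exact h.coeFn_toLp

theorem coeFn_mulLp {m : Space n → ℝ} {M : ℝ} (hm : Measurable m) (hM : ∀ ξ, |m ξ| ≤ M)
    (f : L2 n) : mulLp m f =ᵐ[volume] fun ξ => (m ξ : ℂ) * f ξ :=
  coeFn_mulLp_of_memLp (memLp_mul_of_bounded hm hM f)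

theorem norm_sq_eq_integral (f : L2 n) : ‖f‖ ^ 2 = ∫ ξ, ‖f ξ‖ ^ 2 := by
  have h := L2.inner_def (𝕜 := ℂ) f f
  have h2 : (inner ℂ f f : ℂ) = ((‖f‖ ^ 2 : ℝ) : ℂ) := by
    rw [inner_self_eq_norm_sq_to_K]; norm_cast
  have h3 : ∀ ξ, (inner ℂ (f ξ) (f ξ) : ℂ) = ((‖f ξ‖ ^ 2 : ℝ) : ℂ) := fun ξ => by
    rw [inner_self_eq_norm_sq_to_K]; norm_cast
  simp_rw [h2, h3] at h
  have h4 : ((‖f‖ ^ 2 : ℝ) : ℂ) = ((∫ ξ, ‖f ξ‖ ^ 2 : ℝ) : ℂ) := h.trans integral_complex_ofReal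
  exact_mod_cast h4

theorem integrable_norm_sq (f : L2 n) : Integrable (fun ξ => ‖f ξ‖ ^ 2) volume :=
  (memLp_two_iff_integrable_sq_norm (Lp.aestronglyMeasurable f)).1 (Lp.memLp f)

/-- Dominated convergence for multiplication operators. -/
theorem tendsto_mulLp {ι : Type*} {l : Filter ι} [l.IsCountablyGenerated]
    {m : ι → Space n → ℝ} {m₀ : Space n → ℝ} {M : ℝ} (hm : ∀ᶠ i in l, Measurable (m i))
    (hm₀ : Measurable m₀) (hM : ∀ᶠ i in l, ∀ ξ, |m i ξ| ≤ M) (hM₀ : ∀ ξ, |m₀ ξ| ≤ M)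
    (h : ∀ ξ, Tendsto (fun i => m i ξ) l (𝓝 (m₀ ξ))) (f : L2 n) :
    Tendsto (fun i => mulLp (m i) f) l (𝓝 (mulLp m₀ f)) := by
  have key : Tendsto (fun i => ∫ ξ, (m i ξ - m₀ ξ) ^ 2 * ‖f ξ‖ ^ 2) l (𝓝 (∫ _ : Space n, (0 : ℝ))) := by
    refine tendsto_integral_filter_of_dominated_convergence
      (fun ξ => (2 * M) ^ 2 * ‖f ξ‖ ^ 2) ?_ ?_ ((integrable_norm_sq f).const_mul _) ?_
    · filter_upwards [hm] with i hi
      exact ((hi.sub hm₀).pow_const 2).aestronglyMeasurable.mul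
        (integrable_norm_sq f).aestronglyMeasurable
    · filter_upwards [hM] with i hi
      refine Eventually.of_forall fun ξ => ?_
      rw [Real.norm_eq_abs, abs_of_nonneg (by positivity)]
      gcongr ?_ * _
      have h1 := abs_le.1 (hi ξ)
      have h2 := abs_le.1 (hM₀ ξ)
      apply sq_le_sq' <;> linarith [h1.1, h1.2, h2.1, h2.2]
    · refine Eventually.of_forall fun ξ => ?_
      have := (((h ξ).sub_const (m₀ ξ)).pow 2).mul_const (‖f ξ‖ ^ 2)
      simpa using this
  rw [integral_zero] at key
  rw [tendsto_iff_norm_sub_tendsto_zero]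
  have hsq : Tendsto (fun i => ‖mulLp (m i) f - mulLp m₀ f‖ ^ 2) l (𝓝 0) := by
    refine key.congr' ?_
    filter_upwards [hm, hM] with i hi hi'
    rw [norm_sq_eq_integral]
    refine integral_congr_ae ?_
    filter_upwards [Lp.coeFn_sub (mulLp (m i) f) (mulLp m₀ f), coeFn_mulLp hi hi' f,
      coeFn_mulLp hm₀ hM₀ f] with ξ h1 h2 h3
    rw [h1, Pi.sub_apply, h2, h3, ← sub_mul, norm_mul, ← Complex.ofReal_sub, Complex.norm_real,
      mul_pow, Real.norm_eq_abs, sq_abs]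
  have := hsq.sqrt
  simpa [Real.sqrt_sq] using this

theorem continuousOn_mulLp {m : ℝ → Space n → ℝ} (hm : ∀ t, 0 ≤ t → Measurable (m t))
    (hc : ∀ ξ, ContinuousOn (fun t => m t ξ) (Ici 0))
    (hM : ∀ T, ∃ M, ∀ t, 0 ≤ t → t ≤ T → ∀ ξ, |m t ξ| ≤ M) (f : L2 n) :
    ContinuousOn (fun t => mulLp (m t) f) (Ici 0) := by
  intro t ht
  obtain ⟨M, hM⟩ := hM (t + 1)
  have hlt : ∀ᶠ s in 𝓝[Ici 0] t, s ≤ t + 1 :=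
    nhdsWithin_le_nhds (Iic_mem_nhds (lt_add_one t))
  refine tendsto_mulLp (M := M) ?_ (hm t ht) ?_ (hM t ht (lt_add_one t).le)
    (fun ξ => hc ξ t ht) f
  · filter_upwards [self_mem_nhdsWithin] with s hs using hm s hs
  · filter_upwards [self_mem_nhdsWithin, hlt] with s hs hs' using hM s hs hs'

/-- By the mean value inequality the difference quotients of `m` are bounded by a local bound for
`m'`, uniformly in `ξ`, so dominated convergence applies to them. -/
theorem hasDerivWithinAt_mulLp {m m' : ℝ → Space n → ℝ} (hm : ∀ t, 0 ≤ t → Measurable (m t))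
    (hm' : ∀ t, 0 ≤ t → Measurable (m' t))
    (hd : ∀ ξ t, 0 ≤ t → HasDerivWithinAt (fun t => m t ξ) (m' t ξ) (Ici 0) t)
    (hM : ∀ t, 0 ≤ t → ∃ M, ∀ ξ, |m t ξ| ≤ M)
    (hM' : ∀ T, ∃ M, ∀ t, 0 ≤ t → t ≤ T → ∀ ξ, |m' t ξ| ≤ M) (f : L2 n) {t : ℝ} (ht : 0 ≤ t) :
    HasDerivWithinAt (fun t => mulLp (m t) f) (mulLp (m' t) f) (Ici 0) t := by
  rw [hasDerivWithinAt_iff_tendsto_slope]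
  obtain ⟨M, hMb⟩ := hM' (t + 1)
  have hlt : ∀ᶠ s in 𝓝[Ici 0 \ {t}] t, s ≤ t + 1 :=
    nhdsWithin_le_nhds (Iic_mem_nhds (lt_add_one t))
  have key : Tendsto (fun s => mulLp (fun ξ => slope (fun t => m t ξ) t s) f) (𝓝[Ici 0 \ {t}] t)
      (𝓝 (mulLp (m' t) f)) := by
    refine tendsto_mulLp (M := M) ?_ (hm' t ht) ?_ (hMb t ht (lt_add_one t).le)
      (fun ξ => hasDerivWithinAt_iff_tendsto_slope.1 (hd ξ t ht)) f
    · filter_upwards [self_mem_nhdsWithin] with s hs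
      simp only [slope_def_field]
      exact ((hm s hs.1).sub (hm t ht)).div_const _
    · filter_upwards [self_mem_nhdsWithin, hlt] with s hs hs' ξ
      have hb := Convex.norm_image_sub_le_of_norm_hasDerivWithin_le (s := Icc 0 (t + 1))
        (f := fun t => m t ξ) (f' := fun t => m' t ξ) (C := M)
        (fun x hx => (hd ξ x hx.1).mono Icc_subset_Ici_self) (fun x hx => hMb x hx.1 hx.2 ξ)
        (convex_Icc _ _) (x := t) (y := s) ⟨ht, (lt_add_one t).le⟩ ⟨hs.1, hs'⟩
      have hne : 0 < |s - t| := abs_pos.2 (sub_ne_zero.2 hs.2)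
      rw [slope_def_field, abs_div, div_le_iff₀ hne]
      exact hb
  refine key.congr' ?_
  filter_upwards [self_mem_nhdsWithin] with s hs
  obtain ⟨A, hA⟩ := hM s hs.1
  obtain ⟨B, hB⟩ := hM t ht
  rw [slope_def_module]
  apply Lp.ext
  have hme : MemLp (fun ξ => ((slope (fun t => m t ξ) t s : ℝ) : ℂ) * f ξ) 2 volume := by
    refine memLp_mul_of_bounded (M := |(s - t)⁻¹| * (A + B)) ?_ (fun ξ => ?_) f
    · simp only [slope_def_field]
      exact ((hm s hs.1).sub (hm t ht)).div_const _
    · rw [slope_def_module, smul_eq_mul, abs_mul]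
      gcongr
      exact (abs_sub _ _).trans (add_le_add (hA ξ) (hB ξ))
  filter_upwards [coeFn_mulLp_of_memLp hme, Lp.coeFn_smul (s - t)⁻¹ (mulLp (m s) f - mulLp (m t) f),
    Lp.coeFn_sub (mulLp (m s) f) (mulLp (m t) f), coeFn_mulLp (hm s hs.1) hA f,
    coeFn_mulLp (hm t ht) hB f] with ξ h1 h2 h3 h4 h5
  rw [h1, h2, Pi.smul_apply, h3, Pi.sub_apply, h4, h5, slope_def_module]
  simp only [smul_eq_mul, Complex.real_smul]
  push_cast
  ring

/-- Membership in the domain is automatic on the right: the product agrees a.e. with an element of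
`L²`. -/
theorem mem_graph_fourierMultiplier {m : Space n → ℝ} {f g : L2 n} :
    (f, g) ∈ (fourierMultiplier m).graph ↔
      fourierL2 n g =ᵐ[volume] fun ξ => (m ξ : ℂ) * fourierL2 n f ξ := by
  rw [LinearPMap.mem_graph_iff]
  constructor
  · rintro ⟨⟨f', hf'⟩, rfl, h⟩
    have h2 : (fourierL2 n).symm (symbolMul m ⟨f', hf'⟩) = g := h
    rw [← h2, LinearIsometryEquiv.apply_symm_apply]
    exact MemLp.coeFn_toLp (memLp_of_mem hf')
  · intro h
    have hf : MemLp (fun ξ => (m ξ : ℂ) * fourierL2 n f ξ) 2 volume :=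
      (memLp_congr_ae h).1 (Lp.memLp _)
    refine ⟨⟨f, hf⟩, rfl, ?_⟩
    change (fourierL2 n).symm (symbolMul m ⟨f, hf⟩) = g
    rw [LinearIsometryEquiv.symm_apply_eq]
    apply Lp.ext
    exact (MemLp.coeFn_toLp hf).trans h.symm

end Multiplication

/-! ### The scalar oscillator at a fixed frequency and its uniform bounds. -/

/-- The solution of `y'' = d y`, `y(0) = 0`, `y'(0) = 1`. -/
def genSin (d t : ℝ) : ℝ :=
  if 0 < d then Real.sinh (√d * t) / √d else if d < 0 then Real.sin (√(-d) * t) / √(-d) else t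

/-- The solution of `y'' = d y`, `y(0) = 1`, `y'(0) = 0`. -/
def genCos (d t : ℝ) : ℝ :=
  if 0 < d then Real.cosh (√d * t) else if d < 0 then Real.cos (√(-d) * t) else 1

theorem hasDerivAt_genSin (d t : ℝ) : HasDerivAt (genSin d) (genCos d t) t := by
  unfold genSin genCos
  split_ifs with h1 h2
  · have hs : √d ≠ 0 := (Real.sqrt_pos.2 h1).ne'
    exact ((hasDerivAt_const_mul (√d)).sinh.div_const (√d)).congr_deriv (by field_simp)
  · have hs : √(-d) ≠ 0 := (Real.sqrt_pos.2 (by linarith)).ne'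
    exact ((hasDerivAt_const_mul (√(-d))).sin.div_const (√(-d))).congr_deriv (by field_simp)
  · exact hasDerivAt_id t

theorem hasDerivAt_genCos (d t : ℝ) : HasDerivAt (genCos d) (d * genSin d t) t := by
  unfold genSin genCos
  split_ifs with h1 h2
  · have hs : √d ≠ 0 := (Real.sqrt_pos.2 h1).ne'
    refine (hasDerivAt_const_mul (√d)).cosh.congr_deriv ?_
    field_simp
    rw [Real.sq_sqrt h1.le, mul_comm]
  · have hs : √(-d) ≠ 0 := (Real.sqrt_pos.2 (by linarith)).ne'
    refine (hasDerivAt_const_mul (√(-d))).cos.congr_deriv ?_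
    field_simp
    rw [Real.sq_sqrt (by linarith)]
    ring
  · have hd : d = 0 := by linarith
    simpa [hd] using hasDerivAt_const t (1 : ℝ)

@[simp] theorem genSin_zero (d : ℝ) : genSin d 0 = 0 := by simp [genSin]

@[simp] theorem genCos_zero (d : ℝ) : genCos d 0 = 1 := by simp [genCos]

theorem measurable_genSin : Measurable (Function.uncurry genSin) := by
  unfold Function.uncurry genSin
  refine Measurable.ite (measurableSet_lt measurable_const measurable_fst) (by fun_prop) ?_
  exact Measurable.ite (measurableSet_lt measurable_fst measurable_const) (by fun_prop) (by fun_prop)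

theorem measurable_genCos : Measurable (Function.uncurry genCos) := by
  unfold Function.uncurry genCos
  refine Measurable.ite (measurableSet_lt measurable_const measurable_fst) (by fun_prop) ?_
  exact Measurable.ite (measurableSet_lt measurable_fst measurable_const) (by fun_prop) (by fun_prop)

/-- The solution of `y'' + a y + a y' = 0`, `y(0) = 0`, `y'(0) = 1`. -/
def waveKernel (a t : ℝ) : ℝ := Real.exp (-(a / 2) * t) * genSin (a ^ 2 / 4 - a) t

/-- The time derivative of `waveKernel`. -/
def waveKernelDeriv (a t : ℝ) : ℝ :=
  Real.exp (-(a / 2) * t) * (genCos (a ^ 2 / 4 - a) t - a / 2 * genSin (a ^ 2 / 4 - a) t)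

theorem hasDerivAt_waveKernel (a t : ℝ) :
    HasDerivAt (waveKernel a) (waveKernelDeriv a t) t := by
  have he : HasDerivAt (fun t => Real.exp (-(a / 2) * t)) (Real.exp (-(a / 2) * t) * (-(a / 2))) t := by
    simpa using ((hasDerivAt_id t).const_mul (-(a / 2))).exp
  refine (he.mul (hasDerivAt_genSin (a ^ 2 / 4 - a) t)).congr_deriv ?_
  unfold waveKernelDeriv
  ring

/-- The substitution `y = exp(-at/2) z` removes the damping term and leaves `z'' = (a²/4 - a) z`,
whence the parameter of `genSin` and `genCos`. -/
theorem hasDerivAt_waveKernelDeriv (a t : ℝ) :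
    HasDerivAt (waveKernelDeriv a) (-a * waveKernel a t - a * waveKernelDeriv a t) t := by
  have he : HasDerivAt (fun t => Real.exp (-(a / 2) * t)) (Real.exp (-(a / 2) * t) * (-(a / 2))) t := by
    simpa using ((hasDerivAt_id t).const_mul (-(a / 2))).exp
  refine (he.mul ((hasDerivAt_genCos (a ^ 2 / 4 - a) t).sub
    ((hasDerivAt_genSin (a ^ 2 / 4 - a) t).const_mul (a / 2)))).congr_deriv ?_
  unfold waveKernel waveKernelDeriv
  simp only [Pi.sub_apply]
  ring

@[simp] theorem waveKernel_zero (a : ℝ) : waveKernel a 0 = 0 := by simp [waveKernel]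

@[simp] theorem waveKernelDeriv_zero (a : ℝ) : waveKernelDeriv a 0 = 1 := by simp [waveKernelDeriv]

theorem continuous_waveKernel (a : ℝ) : Continuous (waveKernel a) :=
  continuous_iff_continuousAt.2 fun t => (hasDerivAt_waveKernel a t).continuousAt

theorem continuous_waveKernelDeriv (a : ℝ) : Continuous (waveKernelDeriv a) :=
  continuous_iff_continuousAt.2 fun t => (hasDerivAt_waveKernelDeriv a t).continuousAt

theorem measurable_waveKernel : Measurable (Function.uncurry waveKernel) := by
  have : Measurable fun p : ℝ × ℝ => ((p.1 ^ 2 / 4 - p.1, p.2) : ℝ × ℝ) := by fun_prop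
  have h := measurable_genSin.comp this
  have he : Measurable fun p : ℝ × ℝ => Real.exp (-(p.1 / 2) * p.2) := by fun_prop
  exact he.mul h

theorem measurable_waveKernelDeriv : Measurable (Function.uncurry waveKernelDeriv) := by
  have : Measurable fun p : ℝ × ℝ => ((p.1 ^ 2 / 4 - p.1, p.2) : ℝ × ℝ) := by fun_prop
  have h := measurable_genSin.comp this
  have h' := measurable_genCos.comp this
  have he : Measurable fun p : ℝ × ℝ => Real.exp (-(p.1 / 2) * p.2) := by fun_prop
  exact he.mul (h'.sub ((measurable_fst.div_const 2).mul h))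

/-- The energy of `waveKernel` is nonincreasing. -/
theorem waveKernel_energy_le {a t : ℝ} (ha : 0 ≤ a) (ht : 0 ≤ t) :
    waveKernelDeriv a t ^ 2 + a * waveKernel a t ^ 2 ≤ 1 := by
  have hd : ∀ s, HasDerivAt (fun s => waveKernelDeriv a s ^ 2 + a * waveKernel a s ^ 2)
      (-(2 * a * waveKernelDeriv a s ^ 2)) s := fun s => by
    refine (((hasDerivAt_waveKernelDeriv a s).pow 2).add
      (((hasDerivAt_waveKernel a s).pow 2).const_mul a)).congr_deriv ?_
    push_cast
    ring
  have hanti : Antitone (fun s => waveKernelDeriv a s ^ 2 + a * waveKernel a s ^ 2) :=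
    antitone_of_deriv_nonpos (fun s => (hd s).differentiableAt) fun s => by
      rw [(hd s).deriv]
      have : 0 ≤ 2 * a * waveKernelDeriv a s ^ 2 := by positivity
      linarith
  simpa using hanti ht

theorem abs_waveKernelDeriv_le {a t : ℝ} (ha : 0 ≤ a) (ht : 0 ≤ t) :
    |waveKernelDeriv a t| ≤ 1 := by
  have h := waveKernel_energy_le ha ht
  have : 0 ≤ a * waveKernel a t ^ 2 := by positivity
  exact abs_le_one_iff_mul_self_le_one.2 (by nlinarith)

/-- Uniformity in `a` is what puts the solution in `D(L^{1/2})` for arbitrary data in `L²`. -/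
theorem abs_sqrt_mul_waveKernel_le {a t : ℝ} (ha : 0 ≤ a) (ht : 0 ≤ t) :
    |√a * waveKernel a t| ≤ 1 := by
  have h := waveKernel_energy_le ha ht
  refine abs_le_one_iff_mul_self_le_one.2 ?_
  have : √a * waveKernel a t * (√a * waveKernel a t) = a * waveKernel a t ^ 2 := by
    calc _ = (√a * √a) * waveKernel a t ^ 2 := by ring
      _ = _ := by rw [Real.mul_self_sqrt ha]
  nlinarith [sq_nonneg (waveKernelDeriv a t)]

theorem abs_waveKernel_le {a t : ℝ} (ha : 0 ≤ a) (ht : 0 ≤ t) : |waveKernel a t| ≤ t := by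
  have hb := Convex.norm_image_sub_le_of_norm_hasDerivWithin_le (s := Ici 0)
    (f := waveKernel a) (f' := waveKernelDeriv a) (C := 1)
    (fun x _ => (hasDerivAt_waveKernel a x).hasDerivWithinAt)
    (fun x hx => abs_waveKernelDeriv_le ha hx) (convex_Ici _) (x := 0) (y := t)
    self_mem_Ici ht
  simpa [abs_of_nonneg ht] using hb

/-- The time primitive of `waveKernel`. -/
def waveKernelInt (a t : ℝ) : ℝ := ∫ s in (0 : ℝ)..t, waveKernel a s

theorem hasDerivAt_waveKernelInt (a t : ℝ) :
    HasDerivAt (waveKernelInt a) (waveKernel a t) t :=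
  intervalIntegral.integral_hasDerivAt_right ((continuous_waveKernel a).intervalIntegrable _ _)
    ((continuous_waveKernel a).stronglyMeasurableAtFilter _ _) (continuous_waveKernel a).continuousAt

@[simp] theorem waveKernelInt_zero (a : ℝ) : waveKernelInt a 0 = 0 := by simp [waveKernelInt]

theorem measurable_waveKernelInt {t : ℝ} (ht : 0 ≤ t) :
    Measurable fun a => waveKernelInt a t := by
  simp only [waveKernelInt, intervalIntegral.integral_of_le ht]
  exact (measurable_waveKernel.stronglyMeasurable.integral_prod_right').measurable

theorem abs_waveKernelInt_le {a t : ℝ} (ha : 0 ≤ a) (ht : 0 ≤ t) :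
    |waveKernelInt a t| ≤ t * t := by
  have := intervalIntegral.norm_integral_le_of_norm_le_const (a := 0) (b := t) (C := t)
    (f := waveKernel a) fun x hx => by
      rw [uIoc_of_le ht] at hx
      exact (abs_waveKernel_le ha hx.1.le).trans hx.2
  simpa [waveKernelInt, abs_of_nonneg ht] using this

/-- This is the oscillator equation integrated once in time, the scalar form of the mild
formulation. -/
theorem mul_waveKernelInt_add (a t : ℝ) :
    a * (waveKernelInt a t + waveKernel a t) = 1 - waveKernelDeriv a t := by
  have hd : ∀ s, HasDerivAt
      (fun s => a * (waveKernelInt a s + waveKernel a s) + waveKernelDeriv a s) 0 s := fun s => by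
    refine ((((hasDerivAt_waveKernelInt a s).add (hasDerivAt_waveKernel a s)).const_mul a).add
      (hasDerivAt_waveKernelDeriv a s)).congr_deriv ?_
    ring
  have := is_const_of_deriv_eq_zero (fun s => (hd s).differentiableAt) (fun s => (hd s).deriv) t 0
  simp at this
  linarith

/-! ### Existence of the mild solution. -/

section Solution

variable {n : ℕ}

theorem logSymbol_nonneg (ξ : Space n) : 0 ≤ logSymbol ξ :=
  Real.log_nonneg (by nlinarith [sq_nonneg (2 * Real.pi * ‖ξ‖)])

theorem logSymbol_pos {ξ : Space n} (hξ : ξ ≠ 0) : 0 < logSymbol ξ := by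
  have : 0 < ‖ξ‖ := norm_pos_iff.2 hξ
  exact Real.log_pos (by have : 0 < (2 * Real.pi * ‖ξ‖) ^ 2 := by positivity
                         linarith)

@[fun_prop] theorem measurable_logSymbol : Measurable (logSymbol (n := n)) := by
  unfold logSymbol
  fun_prop

/-- The solution operator `𝓕⁻¹ k(λ, t) 𝓕` of the Cauchy problem with zero initial value. -/
def waveSol (u₁ : L2 n) (t : ℝ) : L2 n :=
  (fourierL2 n).symm (mulLp (fun ξ => waveKernel (logSymbol ξ) t) (fourierL2 n u₁))

theorem measurable_comp_logSymbol {k : ℝ → ℝ → ℝ} (hk : Measurable (Function.uncurry k)) (t : ℝ) :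
    Measurable fun ξ : Space n => k (logSymbol ξ) t :=
  hk.comp (measurable_logSymbol.prodMk measurable_const)

theorem coeFn_fourierL2_waveSol (u₁ : L2 n) {t : ℝ} (ht : 0 ≤ t) :
    fourierL2 n (waveSol u₁ t) =ᵐ[volume]
      fun ξ => (waveKernel (logSymbol ξ) t : ℂ) * fourierL2 n u₁ ξ := by
  rw [waveSol, LinearIsometryEquiv.apply_symm_apply]
  exact coeFn_mulLp (measurable_comp_logSymbol measurable_waveKernel t)
    (fun ξ => abs_waveKernel_le (logSymbol_nonneg ξ) ht) _

theorem hasDerivWithinAt_fourierL2_symm {f : ℝ → L2 n} {f' : L2 n} {s : Set ℝ} {t : ℝ}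
    (h : HasDerivWithinAt f f' s t) :
    HasDerivWithinAt (fun t => (fourierL2 n).symm (f t)) ((fourierL2 n).symm f') s t :=
  (((fourierL2 n).symm.toContinuousLinearEquiv.toContinuousLinearMap.restrictScalars
    ℝ).hasFDerivAt.comp_hasDerivWithinAt t h :)

theorem isMildSolution_waveSol (u₁ : L2 n) : IsMildSolution 0 u₁ (waveSol u₁) := by
  set φ := fourierL2 n u₁ with hφ
  have hk := fun t => measurable_comp_logSymbol (n := n) measurable_waveKernel t
  have hk' := fun t => measurable_comp_logSymbol (n := n) measurable_waveKernelDeriv t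
  have hK : ∀ t : ℝ, 0 ≤ t → Measurable fun ξ : Space n => waveKernelInt (logSymbol ξ) t :=
    fun t ht => (measurable_waveKernelInt ht).comp measurable_logSymbol
  have hsq : ∀ t : ℝ, Measurable fun ξ : Space n => √(logSymbol ξ) * waveKernel (logSymbol ξ) t :=
    fun t => measurable_logSymbol.sqrt.mul (hk t)
  have hder : ∀ t : ℝ, 0 ≤ t → HasDerivWithinAt (waveSol u₁)
      ((fourierL2 n).symm (mulLp (fun ξ => waveKernelDeriv (logSymbol ξ) t) φ)) (Ici 0) t :=
    fun t ht => hasDerivWithinAt_fourierL2_symm <| hasDerivWithinAt_mulLp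
      (m := fun t ξ => waveKernel (logSymbol ξ) t) (m' := fun t ξ => waveKernelDeriv (logSymbol ξ) t)
      (fun t _ => hk t) (fun t _ => hk' t)
      (fun ξ t _ => (hasDerivAt_waveKernel _ t).hasDerivWithinAt)
      (fun t ht => ⟨t, fun ξ => abs_waveKernel_le (logSymbol_nonneg ξ) ht⟩)
      (fun T => ⟨1, fun t ht _ ξ => abs_waveKernelDeriv_le (logSymbol_nonneg ξ) ht⟩) φ ht
  -- The `L²`-valued integral is found by the fundamental theorem of calculus in `L²`: the
  -- multiplier with symbol `waveKernelInt` has derivative `waveSol` and vanishes at time 0.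
  have hint : ∀ t : ℝ, 0 ≤ t → ∫ s in (0 : ℝ)..t, waveSol u₁ s =
      (fourierL2 n).symm (mulLp (fun ξ => waveKernelInt (logSymbol ξ) t) φ) := by
    intro t ht
    have hV : ∀ t : ℝ, 0 ≤ t → HasDerivWithinAt
        (fun t => (fourierL2 n).symm (mulLp (fun ξ => waveKernelInt (logSymbol ξ) t) φ))
        (waveSol u₁ t) (Ici 0) t :=
      fun t ht => hasDerivWithinAt_fourierL2_symm <| hasDerivWithinAt_mulLp
        (m := fun t ξ => waveKernelInt (logSymbol ξ) t) (m' := fun t ξ => waveKernel (logSymbol ξ) t)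
        hK (fun t _ => hk t)
        (fun ξ t _ => (hasDerivAt_waveKernelInt _ t).hasDerivWithinAt)
        (fun t ht => ⟨t * t, fun ξ => abs_waveKernelInt_le (logSymbol_nonneg ξ) ht⟩)
        (fun T => ⟨T, fun t ht htT ξ => (abs_waveKernel_le (logSymbol_nonneg ξ) ht).trans htT⟩) φ ht
    have h0 : mulLp (fun ξ : Space n => waveKernelInt (logSymbol ξ) 0) φ = 0 := by
      apply Lp.ext
      filter_upwards [coeFn_mulLp (hK 0 le_rfl)
        (fun ξ => abs_waveKernelInt_le (logSymbol_nonneg ξ) le_rfl) φ,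
        Lp.coeFn_zero ℂ 2 (volume : Measure (Space n))] with ξ h1 h2
      rw [h1, h2]
      simp
    rw [intervalIntegral.integral_eq_sub_of_hasDeriv_right_of_le ht
      (f := fun t => (fourierL2 n).symm (mulLp (fun ξ => waveKernelInt (logSymbol ξ) t) φ)),
      h0, map_zero, sub_zero]
    · exact fun s hs => ((hV s hs.1).continuousWithinAt).mono Icc_subset_Ici_self
    · exact fun s hs => ((hV s hs.1.le).hasDerivAt (Ici_mem_nhds hs.1)).hasDerivWithinAt
    · refine ContinuousOn.intervalIntegrable fun s hs => ?_
      rw [uIcc_of_le ht] at hs ⊢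
      exact ((hder s hs.1).continuousWithinAt).mono Icc_subset_Ici_self
  have hcont := fun {f : ℝ → L2 n} (hf : ContinuousOn f (Ici 0)) =>
    (fourierL2 n).symm.continuous.comp_continuousOn hf
  refine ⟨fun t => (fourierL2 n).symm (mulLp (fun ξ => waveKernelDeriv (logSymbol ξ) t) φ),
    fun t => (fourierL2 n).symm
      (mulLp (fun ξ => √(logSymbol ξ) * waveKernel (logSymbol ξ) t) φ), hder, ?_, ?_, ?_, ?_, ?_, ?_⟩
  · exact hcont <| continuousOn_mulLp (m := fun t ξ => waveKernelDeriv (logSymbol ξ) t)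
      (fun t _ => hk' t) (fun ξ => (continuous_waveKernelDeriv _).continuousOn)
      (fun T => ⟨1, fun t ht _ ξ => abs_waveKernelDeriv_le (logSymbol_nonneg ξ) ht⟩) φ
  · intro t ht
    rw [opLSqrt, mem_graph_fourierMultiplier, LinearIsometryEquiv.apply_symm_apply]
    filter_upwards [coeFn_fourierL2_waveSol u₁ ht, coeFn_mulLp (hsq t)
      (fun ξ => abs_sqrt_mul_waveKernel_le (logSymbol_nonneg ξ) ht) φ] with ξ h1 h2
    rw [h1, h2]
    push_cast
    ring
  · exact hcont <| continuousOn_mulLp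
      (m := fun t ξ => √(logSymbol ξ) * waveKernel (logSymbol ξ) t) (fun t _ => hsq t)
      (fun ξ => (continuous_const.mul (continuous_waveKernel _)).continuousOn)
      (fun T => ⟨1, fun t ht _ ξ => abs_sqrt_mul_waveKernel_le (logSymbol_nonneg ξ) ht⟩) φ
  · rw [← (fourierL2 n).map_eq_zero_iff]
    apply Lp.ext
    filter_upwards [coeFn_fourierL2_waveSol u₁ le_rfl,
      Lp.coeFn_zero ℂ 2 (volume : Measure (Space n))] with ξ h1 h2
    rw [h1, h2]
    simp
  · simp only
    rw [LinearIsometryEquiv.symm_apply_eq]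
    apply Lp.ext
    filter_upwards [coeFn_mulLp (hk' 0)
      (fun ξ => abs_waveKernelDeriv_le (logSymbol_nonneg ξ) le_rfl) φ] with ξ h1
    rw [h1]
    simp [hφ]
  · intro t ht
    rw [opL, mem_graph_fourierMultiplier, sub_zero, hint t ht, map_sub, map_add,
      LinearIsometryEquiv.apply_symm_apply, LinearIsometryEquiv.apply_symm_apply]
    filter_upwards [coeFn_fourierL2_waveSol u₁ ht, coeFn_mulLp (hk' t)
      (fun ξ => abs_waveKernelDeriv_le (logSymbol_nonneg ξ) ht) φ, coeFn_mulLp (hK t ht)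
      (fun ξ => abs_waveKernelInt_le (logSymbol_nonneg ξ) ht) φ,
      Lp.coeFn_sub (fourierL2 n u₁) (mulLp (fun ξ => waveKernelDeriv (logSymbol ξ) t) φ),
      Lp.coeFn_add (mulLp (fun ξ => waveKernelInt (logSymbol ξ) t) φ)
        (fourierL2 n (waveSol u₁ t))] with ξ h1 h2 h3 h4 h5
    rw [h4, h5, Pi.sub_apply, Pi.add_apply, h1, h2, h3]
    have := congrArg (fun x : ℝ => (x : ℂ)) (mul_waveKernelInt_add (logSymbol ξ) t)
    push_cast at this
    rw [← hφ]
    linear_combination (-(φ ξ)) * this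

/-! ### Uniqueness of the mild solution. -/

theorem exists_mulCLM {m : Space n → ℝ} {M : ℝ} (hm : Measurable m) (hM : ∀ ξ, |m ξ| ≤ M) :
    ∃ A : L2 n →L[ℝ] L2 n, ∀ f, A f =ᵐ[volume] fun ξ => (m ξ : ℂ) * f ξ := by
  have hco := coeFn_mulLp hm hM
  let A₀ : L2 n →ₗ[ℝ] L2 n :=
    { toFun := mulLp m
      map_add' := fun f g => by
        apply Lp.ext
        filter_upwards [hco f, hco g, hco (f + g), Lp.coeFn_add f g,
          Lp.coeFn_add (mulLp m f) (mulLp m g)] with ξ h1 h2 h3 h4 h5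
        rw [h3, h4, h5, Pi.add_apply, Pi.add_apply, h1, h2, mul_add]
      map_smul' := fun c f => by
        apply Lp.ext
        filter_upwards [hco f, hco (c • f), Lp.coeFn_smul c f,
          Lp.coeFn_smul c (mulLp m f)] with ξ h1 h2 h3 h4
        rw [RingHom.id_apply, h2, h3, h4, Pi.smul_apply, Pi.smul_apply, h1, mul_smul_comm] }
  refine ⟨A₀.mkContinuous M fun f => ?_, hco⟩
  refine Lp.norm_le_mul_norm_of_ae_le_mul ?_
  filter_upwards [hco f] with ξ h1
  change ‖mulLp m f ξ‖ ≤ _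
  rw [h1, norm_mul, Complex.norm_real]
  exact mul_le_mul_of_nonneg_right (hM ξ) (norm_nonneg _)

/-- Multiplying by the symbol cut off at height `R` gives a bounded operator, and the cut-off pair
`(∫u, u)` solves an affine ODE with Lipschitz right-hand side. Solutions therefore agree wherever
the symbol is at most `R` and nonzero; then `R → ∞`. -/
theorem IsMildSolution.unique (hn : 1 ≤ n) {u₁ : L2 n} {u v : ℝ → L2 n}
    (hu : IsMildSolution 0 u₁ u) (hv : IsMildSolution 0 u₁ v) {t : ℝ} (ht : 0 ≤ t) :
    u t = v t := by
  have key : ∀ R : ℝ, ∃ A : L2 n →L[ℝ] L2 n,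
      (∀ f, A f =ᵐ[volume]
        fun ξ => (({ξ | logSymbol ξ ≤ R}.indicator logSymbol ξ : ℝ) : ℂ) * f ξ) ∧
      A (fourierL2 n (u t)) = A (fourierL2 n (v t)) := by
    intro R
    have hset : MeasurableSet {ξ : Space n | logSymbol ξ ≤ R} :=
      measurableSet_le measurable_logSymbol measurable_const
    have hb : ∀ ξ : Space n, |{ξ | logSymbol ξ ≤ R}.indicator logSymbol ξ| ≤ |R| := fun ξ => by
      by_cases h : ξ ∈ {ξ : Space n | logSymbol ξ ≤ R}
      · rw [indicator_of_mem h]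
        exact abs_le_abs_of_nonneg (logSymbol_nonneg ξ) h
      · rw [indicator_of_notMem h]
        simp
    obtain ⟨A, hA⟩ := exists_mulCLM (measurable_logSymbol.indicator hset) hb
    refine ⟨A, hA, ?_⟩
    let F : L2 n →L[ℝ] L2 n :=
      (fourierL2 n).toContinuousLinearEquiv.toContinuousLinearMap.restrictScalars ℝ
    let B : L2 n →L[ℝ] L2 n := A.comp F
    -- Freezing `u` at its initial value for negative times makes the integrand continuous on all of
    -- `ℝ`, so the primitive is differentiable at 0 too.
    let D : (ℝ → L2 n) → ℝ → L2 n := fun u t => ∫ s in (0 : ℝ)..t, u (max s 0)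
    let G : L2 n × L2 n → L2 n × L2 n := fun p => (p.2, B u₁ - A (p.1 + p.2))
    have hG : ∃ K, LipschitzWith K G := by
      let G₀ : L2 n × L2 n →L[ℝ] L2 n × L2 n :=
        (ContinuousLinearMap.snd ℝ _ _).prod
          (-(A.comp (ContinuousLinearMap.fst ℝ _ _ + ContinuousLinearMap.snd ℝ _ _)))
      refine ⟨‖G₀‖₊, LipschitzWith.of_dist_le_mul fun p q => ?_⟩
      have : G = fun p => (0, B u₁) + G₀ p := by
        funext p
        simp [G, G₀, sub_eq_add_neg]
      rw [this]
      simp only [dist_add_left]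
      exact G₀.lipschitz.dist_le_mul p q
    obtain ⟨K, hK⟩ := hG
    have hode : ∀ u : ℝ → L2 n, IsMildSolution 0 u₁ u →
        ContinuousOn (fun s => (B (D u s), B (u s))) (Icc 0 t) ∧
        (∀ s ∈ Ico 0 t, HasDerivWithinAt (fun s => (B (D u s), B (u s)))
          (G (B (D u s), B (u s))) (Ici s) s) ∧ (B (D u 0), B (u 0)) = 0 := by
      intro u hu
      obtain ⟨w, -, hw, -, -, -, hu0, -, heq⟩ := hu
      have hc : Continuous fun s => u (max s 0) := by
        have hcon : ContinuousOn u (Ici 0) := fun s hs => (hw s hs).continuousWithinAt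
        exact hcon.comp_continuous (by fun_prop) fun s => le_max_right s 0
      have hD : ∀ s, HasDerivAt (D u) (u (max s 0)) s := fun s =>
        intervalIntegral.integral_hasDerivAt_right (hc.intervalIntegrable _ _)
          (hc.stronglyMeasurableAtFilter _ _) hc.continuousAt
      have hder : ∀ s, 0 ≤ s → HasDerivWithinAt (fun s => (B (D u s), B (u s)))
          (B (u s), B (w s)) (Ici 0) s := fun s hs => by
        have h1 := B.hasFDerivAt.comp_hasDerivWithinAt s ((hD s).hasDerivWithinAt (s := Ici 0))
        have h2 := B.hasFDerivAt.comp_hasDerivWithinAt s (hw s hs)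
        rw [max_eq_left hs] at h1
        exact h1.prodMk h2
      refine ⟨fun s hs => (hder s hs.1).continuousWithinAt.mono Icc_subset_Ici_self,
        fun s hs => ?_, ?_⟩
      · refine ((hder s hs.1).mono (Ici_subset_Ici.2 hs.1)).congr_deriv ?_
        refine Prod.ext rfl ?_
        change B (w s) = B u₁ - A (B (D u s) + B (u s))
        have hDs : D u s = ∫ r in (0 : ℝ)..s, u r := by
          refine intervalIntegral.integral_congr fun r hr => ?_
          rw [uIcc_of_le hs.1] at hr
          rw [max_eq_left hr.1]
        have hg := mem_graph_fourierMultiplier.1 (heq s hs.1)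
        rw [← hDs, sub_zero] at hg
        rw [← map_add]
        have hw' : w s = u₁ - (u₁ - w s) := by abel
        rw [hw', map_sub]
        congr 1
        -- Where the cut-off symbol is nonzero it equals the symbol of `L`, so after applying `A`
        -- the unbounded `L` may be replaced by `A`.
        change A (fourierL2 n _) = A (A (fourierL2 n _))
        apply Lp.ext
        filter_upwards [hA (fourierL2 n (u₁ - w s)), hA (A (fourierL2 n (D u s + u s))),
          hA (fourierL2 n (D u s + u s)), hg] with ξ h1 h2 h3 h4
        rw [h1, h2, h3, h4]
        by_cases h : ξ ∈ {ξ : Space n | logSymbol ξ ≤ R}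
        · rw [indicator_of_mem h]
        · rw [indicator_of_notMem h]
          simp
      · simp [D, hu0]
    obtain ⟨hc1, hd1, h01⟩ := hode u hu
    obtain ⟨hc2, hd2, h02⟩ := hode v hv
    have := ODE_solution_unique (v := fun _ => G) (fun _ => hK) hc1 hd1 hc2 hd2 (h01.trans h02.symm)
      (right_mem_Icc.2 ht)
    exact (Prod.ext_iff.1 this).2
  choose A hA hAeq using key
  apply (fourierL2 n).injective
  apply Lp.ext
  -- In positive dimension the origin, the only zero of the symbol, is a null set.
  have : Nonempty (Fin n) := ⟨⟨0, hn⟩⟩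
  -- Only integer cut-offs are used, so that the exceptional null sets are countably many.
  have hall : ∀ᵐ ξ ∂(volume : Measure (Space n)), ∀ R : ℕ,
      (({ξ : Space n | logSymbol ξ ≤ R}.indicator logSymbol ξ : ℝ) : ℂ) * fourierL2 n (u t) ξ =
      (({ξ : Space n | logSymbol ξ ≤ R}.indicator logSymbol ξ : ℝ) : ℂ) * fourierL2 n (v t) ξ := by
    rw [ae_all_iff]
    intro R
    have h1 := hA R (fourierL2 n (u t))
    rw [hAeq] at h1
    exact h1.symm.trans (hA R (fourierL2 n (v t)))
  have h0 : ∀ᵐ ξ ∂(volume : Measure (Space n)), ξ ≠ 0 := by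
    simp [ae_iff]
  filter_upwards [hall, h0] with ξ h hξ
  obtain ⟨R, hR⟩ := exists_nat_ge (logSymbol ξ)
  have := h R
  rw [indicator_of_mem (show ξ ∈ {ξ : Space n | logSymbol ξ ≤ R} from hR)] at this
  exact mul_left_cancel₀ (Complex.ofReal_ne_zero.2 (logSymbol_pos hξ).ne') this

/-! ### The Fourier integral on `L¹ ∩ L²`. -/

theorem continuous_fourier_of_integrable {f : Space n → ℂ} (hf : Integrable f) :
    Continuous (𝓕 f) :=
  VectorFourier.fourierIntegral_continuous Real.continuous_fourierChar
    (continuous_inner (𝕜 := ℝ) (E := Space n)) hf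

theorem norm_fourier_le_integral_norm (f : Space n → ℂ) (ξ : Space n) :
    ‖𝓕 f ξ‖ ≤ ∫ x, ‖f x‖ :=
  VectorFourier.norm_fourierIntegral_le_integral_norm _ _ _ _ _

theorem fourier_zero_eq_integral (f : Space n → ℂ) : 𝓕 f 0 = ∫ x, f x := by
  simp [Real.fourier_eq]

/-- On `L¹ ∩ L²` the unitary Fourier transform is given by the Fourier integral. -/
theorem fourierL2_ae_eq_fourier {f : L2 n} (hf : Integrable f) :
    fourierL2 n f =ᵐ[volume] 𝓕 (f : Space n → ℂ) := by
  -- Both sides are locally integrable, so testing against smooth compactly supported functions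
  -- suffices. The transform is moved onto the test function by the definition for tempered
  -- distributions on one side, and by Fubini on the other.
  refine ae_eq_of_integral_contDiff_smul_eq
    ((Lp.memLp _).locallyIntegrable one_le_two)
    (continuous_fourier_of_integrable hf).locallyIntegrable fun g g_smooth g_cpt => ?_
  have hg₁ : HasCompactSupport (Complex.ofRealCLM ∘ g) := g_cpt.comp_left rfl
  have hg₂ : ContDiff ℝ ∞ (Complex.ofRealCLM ∘ g) := by fun_prop
  let G : 𝓢(Space n, ℂ) := hg₁.toSchwartzMap hg₂
  have h1 : Lp.toTemperedDistribution (fourierL2 n f) G = Lp.toTemperedDistribution f (𝓕 G) := by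
    rw [← TemperedDistribution.fourier_apply, Lp.fourier_toTemperedDistribution_eq]
    rfl
  rw [Lp.toTemperedDistribution_apply, Lp.toTemperedDistribution_apply] at h1
  have h2 : ∫ x, 𝓕 G x • f x = ∫ x, G x • 𝓕 (f : Space n → ℂ) x := by
    rw [SchwartzMap.fourier_coe]
    have := VectorFourier.integral_fourierIntegral_smul_eq_flip (μ := volume) (ν := volume)
      (L := innerₗ (Space n)) (f := (G : Space n → ℂ)) (g := (f : Space n → ℂ))
      Real.continuous_fourierChar continuous_inner G.integrable hf
    rw [flip_innerₗ] at this
    exact this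
  have h3 := h1.trans h2
  simpa [G] using h3

end Solution

/-! ### Pointwise bounds on the kernel. -/

theorem genSin_of_neg {d : ℝ} (hd : d < 0) (t : ℝ) :
    genSin d t = Real.sin (√(-d) * t) / √(-d) := by
  rw [genSin, if_neg hd.not_gt, if_pos hd]

theorem abs_genSin_le_of_nonpos {d t : ℝ} (hd : d ≤ 0) (ht : 0 ≤ t) : |genSin d t| ≤ t := by
  rcases hd.lt_or_eq with hd | rfl
  · have hs : 0 < √(-d) := Real.sqrt_pos.2 (by linarith)
    rw [genSin_of_neg hd, abs_div, abs_of_pos hs, div_le_iff₀ hs]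
    have := Real.abs_sin_le_abs (x := √(-d) * t)
    rw [abs_of_nonneg (by positivity : 0 ≤ √(-d) * t)] at this
    linarith
  · simp [genSin, abs_of_nonneg ht]

theorem abs_genSin_le_of_pos {d t : ℝ} (hd : 0 < d) (ht : 0 ≤ t) :
    |genSin d t| ≤ t * Real.exp (√d * t) := by
  have hs : 0 < √d := Real.sqrt_pos.2 hd
  have hx : 0 ≤ √d * t := by positivity
  rw [genSin, if_pos hd, abs_div, abs_of_pos hs, div_le_iff₀ hs,
    abs_of_nonneg (Real.sinh_nonneg_iff.2 hx), Real.sinh_eq]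
  set x := √d * t with hxd
  -- `1 - exp(-2x) ≤ 2x` gives `sinh x ≤ x exp x`.
  have h1 : -(2 * x) + 1 ≤ Real.exp (-(2 * x)) := Real.add_one_le_exp _
  have h2 : Real.exp (-x) = Real.exp x * Real.exp (-(2 * x)) := by
    rw [← Real.exp_add]; ring_nf
  have h3 : t * Real.exp x * √d = x * Real.exp x := by rw [hxd]; ring
  rw [h2, h3]
  nlinarith [Real.exp_pos x]

/-- In the oscillatory range `a ≤ 4` the decay rate is `a/2`. For `a > 4` the slow characteristic
root `-a/2 + √(a²/4 - a)` is at most `-1`, because `a²/4 - a ≤ (a/2 - 1)²`; hence the restriction `b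
≤ 1`, however large `a` is. -/
theorem abs_waveKernel_le_exp {a t b : ℝ} (ha : 0 ≤ a) (ht : 0 ≤ t) (hb : b ≤ 1) (hba : b ≤ a / 2) :
    |waveKernel a t| ≤ t * Real.exp (-b * t) := by
  rw [waveKernel, abs_mul, abs_of_pos (Real.exp_pos _)]
  rcases le_or_gt (a ^ 2 / 4 - a) 0 with hd | hd
  · rw [mul_comm]
    have := abs_genSin_le_of_nonpos hd ht
    gcongr
  · have h4 : 4 < a := by
      by_contra! h
      nlinarith
    have hs : √(a ^ 2 / 4 - a) ≤ a / 2 - 1 := by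
      rw [Real.sqrt_le_left (by linarith)]
      nlinarith
    calc Real.exp (-(a / 2) * t) * |genSin (a ^ 2 / 4 - a) t|
        ≤ Real.exp (-(a / 2) * t) * (t * Real.exp (√(a ^ 2 / 4 - a) * t)) := by
          gcongr
          exact abs_genSin_le_of_pos hd ht
      _ = t * Real.exp ((√(a ^ 2 / 4 - a) - a / 2) * t) := by
          rw [mul_left_comm, ← Real.exp_add]
          ring_nf
      _ ≤ t * Real.exp (-b * t) := by
          gcongr
          linarith

theorem waveKernel_sq_eq {a : ℝ} (ha : 0 < a) (ha' : a < 4) (t : ℝ) :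
    waveKernel a t ^ 2 =
      Real.exp (-(a * t)) * Real.sin (√(a - a ^ 2 / 4) * t) ^ 2 / (a - a ^ 2 / 4) := by
  have hd : a ^ 2 / 4 - a < 0 := by nlinarith
  rw [waveKernel, genSin_of_neg hd, neg_sub, mul_pow, div_pow, Real.sq_sqrt (by linarith),
    ← Real.exp_nat_mul, mul_div_assoc]
  push_cast
  ring_nf

theorem waveKernel_sq_le {a : ℝ} (ha : 0 < a) (ha' : a ≤ 2) (t : ℝ) :
    waveKernel a t ^ 2 ≤ Real.exp (-(a * t)) * (2 / a) := by
  have hd : a / 2 ≤ a - a ^ 2 / 4 := by nlinarith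
  rw [waveKernel_sq_eq ha (by linarith), mul_div_assoc]
  refine mul_le_mul_of_nonneg_left ?_ (Real.exp_pos _).le
  calc Real.sin (√(a - a ^ 2 / 4) * t) ^ 2 / (a - a ^ 2 / 4) ≤ 1 / (a / 2) := by
        gcongr
        exact Real.sin_sq_le_one _
    _ = 2 / a := by field_simp

/-- The symbol `log (1 + |2πξ|²)` as a function of `|ξ|`. -/
def logRadial (r : ℝ) : ℝ := Real.log (1 + (2 * Real.pi * r) ^ 2)

theorem logSymbol_eq {n : ℕ} (ξ : Space n) : logSymbol ξ = logRadial ‖ξ‖ := rfl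

theorem logRadial_nonneg (r : ℝ) : 0 ≤ logRadial r :=
  Real.log_nonneg (by nlinarith [sq_nonneg (2 * Real.pi * r)])

@[fun_prop] theorem measurable_logRadial : Measurable logRadial := by
  unfold logRadial
  fun_prop

theorem logRadial_le (r : ℝ) : logRadial r ≤ (2 * Real.pi * r) ^ 2 := by
  have := Real.log_le_sub_one_of_pos (x := 1 + (2 * Real.pi * r) ^ 2) (by positivity)
  unfold logRadial
  linarith

theorem le_logRadial (r : ℝ) :
    (2 * Real.pi * r) ^ 2 / (1 + (2 * Real.pi * r) ^ 2) ≤ logRadial r := by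
  have h := Real.one_sub_inv_le_log_of_pos (x := 1 + (2 * Real.pi * r) ^ 2) (by positivity)
  refine le_trans (le_of_eq ?_) h
  field_simp
  ring

theorem half_le_logRadial {r : ℝ} (hr : (2 * Real.pi * r) ^ 2 ≤ 1) :
    (2 * Real.pi * r) ^ 2 / 2 ≤ logRadial r := by
  refine le_trans ?_ (le_logRadial r)
  gcongr
  linarith

theorem sq_sub_le_logRadial (r : ℝ) :
    (2 * Real.pi * r) ^ 2 - (2 * Real.pi * r) ^ 4 ≤ logRadial r := by
  refine le_trans ?_ (le_logRadial r)
  rw [le_div_iff₀ (by positivity)]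
  nlinarith [sq_nonneg ((2 * Real.pi * r) ^ 3)]

/-! ### The kernel at low frequency. -/

section LowFrequency

variable {r t : ℝ}

theorem waveKernel_logRadial_sq_le_exp (hr : 0 < r) (hr' : 2 * Real.pi * r ≤ 1) (ht : 0 ≤ t) :
    waveKernel (logRadial r) t ^ 2 * r ^ 2 ≤ Real.exp (-(2 * Real.pi ^ 2 * t) * r ^ 2) := by
  have hpi := Real.pi_gt_three
  have hs : 0 < 2 * Real.pi * r := by positivity
  have hs1 : (2 * Real.pi * r) ^ 2 ≤ 1 := pow_le_one₀ hs.le hr'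
  have h1 := half_le_logRadial hs1
  have h2 := logRadial_le r
  have hpos : 0 < logRadial r := lt_of_lt_of_le (by positivity) h1
  have h3 : 2 / logRadial r * r ^ 2 ≤ 1 := by
    rw [div_mul_eq_mul_div, div_le_one hpos]
    refine le_trans ?_ h1
    have : 2 * r ^ 2 * 1 ≤ 2 * r ^ 2 * Real.pi ^ 2 := by
      gcongr
      nlinarith
    linarith [show (2 * Real.pi * r) ^ 2 / 2 = 2 * r ^ 2 * Real.pi ^ 2 by ring]
  calc waveKernel (logRadial r) t ^ 2 * r ^ 2
      ≤ Real.exp (-(logRadial r * t)) * (2 / logRadial r) * r ^ 2 := by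
        gcongr
        exact waveKernel_sq_le hpos (by linarith) t
    _ = Real.exp (-(logRadial r * t)) * (2 / logRadial r * r ^ 2) := by ring
    _ ≤ Real.exp (-(logRadial r * t)) := mul_le_of_le_one_right (Real.exp_pos _).le h3
    _ ≤ _ := by
        gcongr
        have := mul_le_mul_of_nonneg_right h1 ht
        linarith

/-- Adds `k² ≤ t²` to `t²` times `k² r² ≤ 1`. The resulting majorant has an elementary primitive
against both `dr` and `r dr`. -/
theorem waveKernel_logRadial_sq_le (hr : 0 < r) (hr' : 2 * Real.pi * r ≤ 1) (ht : 0 ≤ t) :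
    waveKernel (logRadial r) t ^ 2 ≤ 2 * t ^ 2 / (1 + t ^ 2 * r ^ 2) := by
  rw [le_div_iff₀ (by positivity)]
  have h1 : waveKernel (logRadial r) t ^ 2 * r ^ 2 ≤ 1 :=
    (waveKernel_logRadial_sq_le_exp hr hr' ht).trans <| Real.exp_le_one_iff.2 <| by
      have : 0 ≤ 2 * Real.pi ^ 2 * t * r ^ 2 := by positivity
      linarith
  have h2 : waveKernel (logRadial r) t ^ 2 ≤ t ^ 2 := by
    rw [← sq_abs]
    gcongr
    exact abs_waveKernel_le (logRadial_nonneg r) ht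
  nlinarith [sq_nonneg t]

/-- The true frequency `w` satisfies `w = s + O(s³)` with `s = 2πr`: from `s² - s⁴ ≤ a ≤ s²` one
gets `s² - w² ≤ 2s⁴`, and dividing by `s + w ≥ s` gives the last bound. -/
theorem logRadial_freq_bounds (hr : 0 < r) (hr' : 2 * Real.pi * r ≤ 1) :
    0 < logRadial r ∧ logRadial r < 4 ∧ 0 < logRadial r - logRadial r ^ 2 / 4 ∧
    √(logRadial r - logRadial r ^ 2 / 4) ≤ 2 * Real.pi * r ∧
    2 * Real.pi * r - √(logRadial r - logRadial r ^ 2 / 4) ≤ 2 * (2 * Real.pi * r) ^ 3 := by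
  have hs : 0 < 2 * Real.pi * r := by positivity
  have h0 := le_logRadial r
  have h1 := sq_sub_le_logRadial r
  have h2 := logRadial_le r
  set s := 2 * Real.pi * r
  have hs1 : s ^ 2 ≤ 1 := pow_le_one₀ hs.le hr'
  have hpos : 0 < logRadial r := lt_of_lt_of_le (by positivity) h0
  set a := logRadial r
  have hd : 0 < a - a ^ 2 / 4 := by nlinarith
  refine ⟨hpos, by linarith, hd, ?_, ?_⟩
  · rw [Real.sqrt_le_left hs.le]
    nlinarith
  · set w := √(a - a ^ 2 / 4) with hw
    have hw0 : 0 ≤ w := Real.sqrt_nonneg _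
    have hw2 : w ^ 2 = a - a ^ 2 / 4 := Real.sq_sqrt hd.le
    have ha2 : a ^ 2 ≤ s ^ 4 := by nlinarith
    have hle : s ^ 2 - w ^ 2 ≤ 2 * s ^ 4 := by nlinarith [pow_pos hs 4]
    have : s * (s - w) ≤ s * (2 * s ^ 3) := by
      by_cases hsw : s ≤ w
      · nlinarith [pow_pos hs 4]
      · push Not at hsw
        nlinarith [mul_nonneg hw0 (sub_nonneg.2 hsw.le)]
    exact le_of_mul_le_mul_left this hs

theorem sin_sq_sub_sin_sq_le (x y : ℝ) : Real.sin x ^ 2 - Real.sin y ^ 2 ≤ |x - y| := by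
  have h : Real.sin x ^ 2 - Real.sin y ^ 2 = Real.sin (x + y) * Real.sin (x - y) := by
    rw [Real.sin_add, Real.sin_sub]
    have hx := Real.sin_sq_add_cos_sq x
    have hy := Real.sin_sq_add_cos_sq y
    linear_combination (Real.sin x) ^ 2 * (-hy) + (Real.sin y) ^ 2 * hx
  rw [h]
  refine (le_abs_self _).trans ?_
  rw [abs_mul]
  calc |Real.sin (x + y)| * |Real.sin (x - y)| ≤ 1 * |x - y| := by
        exact mul_le_mul (Real.abs_sin_le_one _) Real.abs_sin_le_abs (abs_nonneg _) zero_le_one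
    _ = _ := one_mul _

/-- Replacing the phase `wt` by `2πrt` costs at most `2(2πr)³t` in `sin²`, which is small when `r ≤
t^(-1/2)` and `t` is large. In that range `at ≤ 4π²`, so the exponential is bounded below. -/
theorem le_waveKernel_logRadial_sq_mul (hr : 0 < r) (hr' : 2 * Real.pi * r ≤ 1) (ht : 0 ≤ t)
    (hrt : r ^ 2 * t ≤ 1) :
    Real.exp (-(4 * Real.pi ^ 2)) / (4 * Real.pi ^ 2) *
      (Real.sin (2 * Real.pi * t * r) ^ 2 - 16 * Real.pi ^ 3 * t * r ^ 3) ≤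
    waveKernel (logRadial r) t ^ 2 * r ^ 2 := by
  obtain ⟨hpos, h4, hd, hle, hge⟩ := logRadial_freq_bounds hr hr'
  have h2 := logRadial_le r
  rw [waveKernel_sq_eq hpos h4]
  set a := logRadial r
  have hw2 : √(a - a ^ 2 / 4) ^ 2 = a - a ^ 2 / 4 := Real.sq_sqrt hd.le
  have hw0 : 0 < √(a - a ^ 2 / 4) := Real.sqrt_pos.2 hd
  set w := √(a - a ^ 2 / 4)
  rw [← hw2]
  have hsin : Real.sin (2 * Real.pi * t * r) ^ 2 - 16 * Real.pi ^ 3 * t * r ^ 3 ≤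
      Real.sin (w * t) ^ 2 := by
    have h := sin_sq_sub_sin_sq_le (2 * Real.pi * t * r) (w * t)
    have heq : 2 * Real.pi * t * r - w * t = (2 * Real.pi * r - w) * t := by ring
    rw [heq, abs_of_nonneg (mul_nonneg (by linarith) ht)] at h
    have := mul_le_mul_of_nonneg_right hge ht
    linarith [show 2 * (2 * Real.pi * r) ^ 3 * t = 16 * Real.pi ^ 3 * t * r ^ 3 by ring]
  have hexp : Real.exp (-(4 * Real.pi ^ 2)) ≤ Real.exp (-(a * t)) := by
    refine Real.exp_le_exp.2 (neg_le_neg ?_)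
    have h := mul_le_mul_of_nonneg_right h2 ht
    have h' := mul_le_mul_of_nonneg_left hrt (by positivity : 0 ≤ 4 * Real.pi ^ 2)
    linarith [show (2 * Real.pi * r) ^ 2 * t = 4 * Real.pi ^ 2 * (r ^ 2 * t) by ring]
  have hfrac : 1 / (4 * Real.pi ^ 2) ≤ r ^ 2 / w ^ 2 := by
    rw [div_le_div_iff₀ (by positivity) (by positivity)]
    nlinarith
  calc Real.exp (-(4 * Real.pi ^ 2)) / (4 * Real.pi ^ 2) *
        (Real.sin (2 * Real.pi * t * r) ^ 2 - 16 * Real.pi ^ 3 * t * r ^ 3)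
      ≤ Real.exp (-(4 * Real.pi ^ 2)) / (4 * Real.pi ^ 2) * Real.sin (w * t) ^ 2 := by gcongr
    _ = Real.exp (-(4 * Real.pi ^ 2)) * (1 / (4 * Real.pi ^ 2)) * Real.sin (w * t) ^ 2 := by ring
    _ ≤ Real.exp (-(a * t)) * (r ^ 2 / w ^ 2) * Real.sin (w * t) ^ 2 := by gcongr
    _ = _ := by ring

/-- Here the phase is at most 1, so the sine has not yet turned and `sin x ≥ x/2`. -/
theorem le_waveKernel_logRadial_sq (hr : 0 < r) (hr' : 2 * Real.pi * r ≤ 1) (ht : 1 ≤ t)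
    (hrt : 2 * Real.pi * r * t ≤ 1) :
    Real.exp (-1) / 4 * t ^ 2 ≤ waveKernel (logRadial r) t ^ 2 := by
  obtain ⟨hpos, h4, hd, hle, -⟩ := logRadial_freq_bounds hr hr'
  have h2 := logRadial_le r
  rw [waveKernel_sq_eq hpos h4]
  set a := logRadial r
  have hw2 : √(a - a ^ 2 / 4) ^ 2 = a - a ^ 2 / 4 := Real.sq_sqrt hd.le
  have hw0 : 0 < √(a - a ^ 2 / 4) := Real.sqrt_pos.2 hd
  set w := √(a - a ^ 2 / 4)
  rw [← hw2]
  have hwt : w * t ≤ 1 := (mul_le_mul_of_nonneg_right hle (by linarith)).trans hrt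
  have hsin : w * t / 2 ≤ Real.sin (w * t) := by
    have h := Real.mul_le_sin (x := w * t) (by positivity) (by linarith [Real.pi_gt_three])
    refine le_trans ?_ h
    rw [div_eq_inv_mul]
    gcongr
    rw [le_div_iff₀ Real.pi_pos]
    linarith [Real.pi_lt_four]
  have hexp : Real.exp (-1) ≤ Real.exp (-(a * t)) := by
    gcongr
    have h := mul_le_mul_of_nonneg_right h2 (by linarith : 0 ≤ t)
    have h' : (2 * Real.pi * r) ^ 2 * t = (2 * Real.pi * r * t) * (2 * Real.pi * r) := by ring
    have : (2 * Real.pi * r * t) * (2 * Real.pi * r) ≤ 1 * 1 := by gcongr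
    linarith
  calc Real.exp (-1) / 4 * t ^ 2 = Real.exp (-1) * (w * t / 2) ^ 2 / w ^ 2 := by
        field_simp
        ring
    _ ≤ Real.exp (-(a * t)) * Real.sin (w * t) ^ 2 / w ^ 2 := by gcongr

end LowFrequency

/-! ### Radial integrals of the kernel: the growth and decay rates. -/

/-- The square of the solution kernel at frequency `r = |ξ|` with the density of polar
coordinates in dimension `n`. -/
def radialDensity (n : ℕ) (t r : ℝ) : ℝ := r ^ (n - 1) * waveKernel (logRadial r) t ^ 2

theorem radialDensity_nonneg (n : ℕ) (t : ℝ) {r : ℝ} (hr : 0 ≤ r) : 0 ≤ radialDensity n t r := by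
  unfold radialDensity
  positivity

theorem measurable_waveKernel_logRadial (t : ℝ) :
    Measurable fun r => waveKernel (logRadial r) t :=
  measurable_waveKernel.comp (measurable_logRadial.prodMk measurable_const)

theorem waveKernel_sq_le_sq {a t : ℝ} (ha : 0 ≤ a) (ht : 0 ≤ t) : waveKernel a t ^ 2 ≤ t ^ 2 := by
  rw [← sq_abs]
  gcongr
  exact abs_waveKernel_le ha ht

theorem integrableOn_radialDensity (n : ℕ) {t a : ℝ} (ht : 0 ≤ t) (ha : 0 ≤ a) (b : ℝ) :
    IntegrableOn (radialDensity n t) (Icc a b) := by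
  refine IntegrableOn.of_bound measure_Icc_lt_top ?_ (b ^ (n - 1) * t ^ 2) ?_
  · exact ((measurable_id.pow_const (n - 1)).mul
      ((measurable_waveKernel_logRadial t).pow_const 2)).aestronglyMeasurable
  · refine (ae_restrict_iff' measurableSet_Icc).2 (Eventually.of_forall fun r hr => ?_)
    have hr0 : 0 ≤ r := ha.trans hr.1
    rw [Real.norm_eq_abs, abs_of_nonneg (radialDensity_nonneg n t hr0)]
    unfold radialDensity
    exact mul_le_mul (pow_le_pow_left₀ hr0 hr.2 _) (waveKernel_sq_le_sq (logRadial_nonneg r) ht)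
      (sq_nonneg _) (pow_nonneg (hr0.trans hr.2) _)

theorem rate_one_sq {t : ℝ} (ht : 0 ≤ t) : rate 1 t ^ 2 = t := by
  rw [rate, if_pos rfl, Real.sq_sqrt ht]

theorem rate_two_sq {t : ℝ} (ht : 1 ≤ t) : rate 2 t ^ 2 = Real.log t := by
  rw [rate, if_neg (by norm_num), if_pos rfl, Real.sq_sqrt (Real.log_nonneg ht)]

theorem rate_add_three_sq (m : ℕ) {t : ℝ} (ht : 0 ≤ t) :
    rate (m + 3) t ^ 2 = t ^ (-((m : ℝ) + 1) / 2) := by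
  rw [rate, if_neg (by omega), if_neg (by omega), ← Real.rpow_mul_natCast ht]
  congr 1
  push_cast
  ring

theorem rate_add_three_sq' (m : ℕ) {t : ℝ} (ht : 0 ≤ t) :
    rate (m + 3) t ^ 2 = (√t)⁻¹ ^ (m + 1) := by
  rw [rate_add_three_sq m ht, inv_pow, Real.sqrt_eq_rpow, ← Real.rpow_mul_natCast ht,
    ← Real.rpow_neg ht]
  congr 1
  push_cast
  ring

theorem eq_one_or_eq_two_or_exists_eq_add_three {n : ℕ} (hn : 1 ≤ n) :
    n = 1 ∨ n = 2 ∨ ∃ m, n = m + 3 := by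
  rcases hn.lt_or_eq with h | h
  · rcases (show 2 ≤ n from h).lt_or_eq with h | h
    · exact .inr (.inr ⟨n - 3, by omega⟩)
    · exact .inr (.inl h.symm)
  · exact .inl h.symm

/-- The majorants integrate to `2t arctan(tr)` for `n = 1`, to `log(1 + t²r²)` for `n = 2`, and to a
Gaussian moment for `n ≥ 3`. The endpoint is where `2πr = 1`. -/
theorem exists_radial_upper {n : ℕ} (hn : 1 ≤ n) :
    ∃ A : ℝ, ∀ᶠ t in atTop,
      ∫ r in (0 : ℝ)..(2 * Real.pi)⁻¹, radialDensity n t r ≤ A * rate n t ^ 2 := by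
  have hpi := Real.pi_gt_three
  have hδ : 0 ≤ (2 * Real.pi)⁻¹ := by positivity
  have hδ1 : (2 * Real.pi)⁻¹ ≤ 1 / 2 := by
    rw [inv_le_comm₀ (by positivity) (by norm_num)]
    linarith
  have hlow : ∀ r ∈ Ioo 0 (2 * Real.pi)⁻¹, 2 * Real.pi * r ≤ 1 := fun r hr => by
    have := mul_le_mul_of_nonneg_left hr.2.le (by positivity : 0 ≤ 2 * Real.pi)
    rwa [mul_inv_cancel₀ (by positivity)] at this
  obtain rfl | rfl | ⟨m, rfl⟩ := eq_one_or_eq_two_or_exists_eq_add_three hn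
  · refine ⟨Real.pi, ?_⟩
    filter_upwards [eventually_ge_atTop 0] with t ht
    rw [rate_one_sq ht]
    have h := intervalIntegral.integral_le_sub_of_hasDeriv_right_of_le hδ
      (g := fun r => 2 * t * Real.arctan (t * r)) (g' := fun r => 2 * t ^ 2 / (1 + t ^ 2 * r ^ 2))
      (by fun_prop) (fun r _ => HasDerivAt.hasDerivWithinAt ?_)
      (integrableOn_radialDensity 1 ht le_rfl _) fun r hr => ?_
    · refine h.trans ?_
      have := Real.arctan_lt_pi_div_two (t * (2 * Real.pi)⁻¹)
      simp only [mul_zero, Real.arctan_zero, sub_zero]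
      nlinarith
    · refine (((hasDerivAt_const_mul t).arctan).const_mul (2 * t)).congr_deriv ?_
      field_simp
    · have := waveKernel_logRadial_sq_le hr.1 (hlow r hr) ht
      simpa [radialDensity] using this
  · refine ⟨2, ?_⟩
    filter_upwards [eventually_ge_atTop 2] with t ht
    rw [rate_two_sq (by linarith)]
    have hpos : ∀ r : ℝ, 0 < 1 + t ^ 2 * r ^ 2 := fun r => by positivity
    have h := intervalIntegral.integral_le_sub_of_hasDeriv_right_of_le hδ
      (g := fun r => Real.log (1 + t ^ 2 * r ^ 2))
      (g' := fun r => r * (2 * t ^ 2 / (1 + t ^ 2 * r ^ 2)))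
      (ContinuousOn.log (by fun_prop) fun r _ => (hpos r).ne')
      (fun r _ => HasDerivAt.hasDerivWithinAt ?_)
      (integrableOn_radialDensity 2 (by linarith) le_rfl _) fun r hr => ?_
    · refine h.trans ?_
      simp only [ne_eq, OfNat.ofNat_ne_zero, not_false_eq_true, zero_pow, mul_zero, add_zero,
        Real.log_one, sub_zero]
      have h2 : 2 * Real.log t = Real.log (t ^ 2) := by rw [Real.log_pow]; norm_num
      rw [h2]
      refine Real.log_le_log (hpos _) ?_
      have : (2 * Real.pi)⁻¹ ^ 2 ≤ (1 / 2) ^ 2 := by gcongr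
      nlinarith [sq_nonneg t]
    · have h1 : HasDerivAt (fun r : ℝ => 1 + t ^ 2 * r ^ 2) (t ^ 2 * (2 * r)) r := by
        simpa using ((hasDerivAt_pow 2 r).const_mul (t ^ 2)).const_add 1
      refine (h1.log (hpos r).ne').congr_deriv ?_
      ring
    · have := waveKernel_logRadial_sq_le hr.1 (hlow r hr) (by linarith : 0 ≤ t)
      have := mul_le_mul_of_nonneg_left this hr.1.le
      simpa [radialDensity] using this
  · refine ⟨(2 * Real.pi ^ 2) ^ (-((m : ℝ) + 1) / 2) * (1 / 2) * Real.Gamma (((m : ℝ) + 1) / 2), ?_⟩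
    filter_upwards [eventually_gt_atTop 0] with t ht
    rw [rate_add_three_sq m ht.le]
    have hb : 0 < 2 * Real.pi ^ 2 * t := by positivity
    have hm : (-1 : ℝ) < m := by linarith [(Nat.cast_nonneg m : (0 : ℝ) ≤ m)]
    have hint := integrableOn_rpow_mul_exp_neg_mul_sq hb hm
    have hval := integral_rpow_mul_exp_neg_mul_rpow (p := 2) two_pos hm hb
    simp only [Real.rpow_two] at hval
    calc ∫ r in (0 : ℝ)..(2 * Real.pi)⁻¹, radialDensity (m + 3) t r
        = ∫ r in Ioo 0 (2 * Real.pi)⁻¹, radialDensity (m + 3) t r := by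
          rw [intervalIntegral.integral_of_le hδ, integral_Ioc_eq_integral_Ioo]
      _ ≤ ∫ r in Ioo 0 (2 * Real.pi)⁻¹, r ^ (m : ℝ) * Real.exp (-(2 * Real.pi ^ 2 * t) * r ^ 2) := by
          refine setIntegral_mono_on
            ((integrableOn_radialDensity _ ht.le le_rfl _).mono_set Ioo_subset_Icc_self)
            (hint.mono_set Ioo_subset_Ioi_self) measurableSet_Ioo fun r hr => ?_
          have := waveKernel_logRadial_sq_le_exp hr.1 (hlow r hr) ht.le
          have := mul_le_mul_of_nonneg_left this (pow_nonneg hr.1.le m)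
          rw [Real.rpow_natCast]
          refine le_trans (le_of_eq ?_) this
          rw [radialDensity, show m + 3 - 1 = m + 2 by omega]
          ring
      _ ≤ ∫ r in Ioi 0, r ^ (m : ℝ) * Real.exp (-(2 * Real.pi ^ 2 * t) * r ^ 2) := by
          refine setIntegral_mono_set hint ?_ Ioo_subset_Ioi_self.eventuallyLE
          refine (ae_restrict_iff' measurableSet_Ioi).2 (Eventually.of_forall fun r hr => ?_)
          have : 0 ≤ r := (mem_Ioi.1 hr).le
          simp only [Pi.zero_apply]
          positivity
      _ = _ := by
          rw [hval, Real.mul_rpow (by positivity) ht.le]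
          ring

/-- The constant does not depend on `ρ`, since the frequencies used lie below `t^(-1/2)` or `1/t`,
hence eventually below `ρ`. This is what later makes the lower constant depend on `n` only, although
`ρ` depends on the data. -/
theorem exists_radial_lower {n : ℕ} (hn : 1 ≤ n) :
    ∃ B : ℝ, 0 < B ∧ ∀ ρ : ℝ, 0 < ρ → ∀ᶠ t in atTop,
      B * rate n t ^ 2 ≤ ∫ r in (0 : ℝ)..ρ, radialDensity n t r := by
  have hpi := Real.pi_gt_three
  have hmono : ∀ {a b ρ t : ℝ}, 0 ≤ t → 0 ≤ a → a ≤ b → b ≤ ρ →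
      ∫ r in a..b, radialDensity n t r ≤ ∫ r in (0 : ℝ)..ρ, radialDensity n t r := by
    intro a b ρ t ht ha hab hbρ
    refine intervalIntegral.integral_mono_interval ha hab hbρ ?_ ?_
    · exact (ae_restrict_iff' measurableSet_Ioc).2
        (Eventually.of_forall fun r hr => radialDensity_nonneg n t hr.1.le)
    · rw [intervalIntegrable_iff_integrableOn_Icc_of_le (ha.trans (hab.trans hbρ))]
      exact integrableOn_radialDensity n ht le_rfl ρ
  have hsqrt : Tendsto (fun t : ℝ => (√t)⁻¹) atTop (𝓝 0) :=
    tendsto_inv_atTop_zero.comp Real.tendsto_sqrt_atTop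
  set c := Real.exp (-(4 * Real.pi ^ 2)) / (4 * Real.pi ^ 2)
  have hc0 : 0 < c := by positivity
  set E := 16 * Real.pi ^ 3
  have hE0 : 0 < E := by positivity
  have hτ : ∀ {t τ : ℝ}, 0 < t → τ = (√t)⁻¹ → τ < (2 * Real.pi)⁻¹ → 0 < τ ∧ t * τ ^ 2 = 1 ∧
      ∀ r ∈ Ioo 0 τ, c * (Real.sin (2 * Real.pi * t * r) ^ 2 - E * t * r ^ 3) ≤
        waveKernel (logRadial r) t ^ 2 * r ^ 2 := by
    intro t τ ht hτ hτ'
    have h0 : 0 < τ := by rw [hτ]; positivity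
    have h1 : t * τ ^ 2 = 1 := by
      rw [hτ, inv_pow, Real.sq_sqrt ht.le, mul_inv_cancel₀ ht.ne']
    refine ⟨h0, h1, fun r hr => le_waveKernel_logRadial_sq_mul hr.1 ?_ ht.le ?_⟩
    · have := mul_le_mul_of_nonneg_left (hr.2.trans hτ').le (by positivity : 0 ≤ 2 * Real.pi)
      rwa [mul_inv_cancel₀ (by positivity)] at this
    · rw [← h1, mul_comm]
      have := pow_le_pow_left₀ hr.1.le hr.2.le 2
      gcongr
  have hhalf : ∀ t r : ℝ, Real.cos (4 * Real.pi * t * r) =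
      1 - 2 * Real.sin (2 * Real.pi * t * r) ^ 2 := fun t r => by
    rw [show 4 * Real.pi * t * r = 2 * (2 * Real.pi * t * r) by ring, Real.cos_two_mul']
    linarith [Real.sin_sq_add_cos_sq (2 * Real.pi * t * r)]
  obtain rfl | rfl | ⟨m, rfl⟩ := eq_one_or_eq_two_or_exists_eq_add_three hn
  -- A density of at least `t²/(4e)` over the interval of length `1/(2πt)`.
  · refine ⟨Real.exp (-1) / (8 * Real.pi), by positivity, fun ρ hρ => ?_⟩
    filter_upwards [eventually_ge_atTop 1, eventually_ge_atTop ρ⁻¹] with t ht htρ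
    have ht0 : 0 < t := by linarith
    rw [rate_one_sq ht0.le]
    set b := (2 * Real.pi * t)⁻¹ with hb
    have hb0 : 0 < b := by positivity
    have hbt : 2 * Real.pi * t * b = 1 := mul_inv_cancel₀ (by positivity)
    have hbρ : b ≤ ρ := by
      rw [hb]
      refine inv_le_of_inv_le₀ hρ (htρ.trans ?_)
      nlinarith
    refine le_trans ?_ (hmono ht0.le le_rfl hb0.le hbρ)
    have h := intervalIntegral.sub_le_integral_of_hasDeriv_right_of_le hb0.le
      (g := fun r => Real.exp (-1) / 4 * t ^ 2 * r) (g' := fun _ => Real.exp (-1) / 4 * t ^ 2)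
      (by fun_prop) (fun r _ => (hasDerivAt_const_mul _).hasDerivWithinAt)
      (integrableOn_radialDensity 1 ht0.le le_rfl _) fun r hr => ?_
    · refine le_trans (le_of_eq ?_) h
      rw [hb]
      field_simp
      ring
    · have h1 : 2 * Real.pi * r * t ≤ 1 := by
        rw [← hbt]
        have := mul_le_mul_of_nonneg_left hr.2.le (by positivity : 0 ≤ 2 * Real.pi * t)
        linarith
      have h2 : 2 * Real.pi * r ≤ 1 := by
        have : 0 < 2 * Real.pi * r := mul_pos (by positivity) hr.1
        nlinarith
      simpa [radialDensity] using le_waveKernel_logRadial_sq hr.1 h2 ht h1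
  -- On `[1/t, t^(-1/2)]` the mean value 1/2 of `sin²` yields `∫ dr/(2r) = (log t)/4`. The errors
  -- total at most `E + 1`, and half of the main term absorbs them.
  · refine ⟨c / 8, by positivity, fun ρ hρ => ?_⟩
    filter_upwards [eventually_ge_atTop 1, hsqrt.eventually_lt_const hρ,
      hsqrt.eventually_lt_const (show 0 < (2 * Real.pi)⁻¹ by positivity),
      Real.tendsto_log_atTop.eventually_ge_atTop (8 * (E + 1))] with t ht h1 h2 h3
    have ht0 : 0 < t := by linarith
    rw [rate_two_sq ht]
    obtain ⟨τ, hτd⟩ : ∃ τ, τ = (√t)⁻¹ := ⟨_, rfl⟩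
    rw [← hτd] at h1 h2
    obtain ⟨hτ0, hτ2, hk⟩ := hτ ht0 hτd h2
    have hτ1 : τ ≤ 1 := by
      by_contra! h
      nlinarith
    have ha0 : 0 < t⁻¹ := by positivity
    have hat : t⁻¹ ≤ τ := by
      rw [inv_le_iff_one_le_mul₀ ht0, ← hτ2]
      nlinarith
    refine le_trans ?_ (hmono ht0.le ha0.le hat h1.le)
    -- The middle term integrates `-cos(4πtr)/(2r)` by parts. Using `1 - sin` instead of `-sin`
    -- gives the leftover `-(1 - sin)/(8πt r²)` a sign, so the derivative is still a lower bound and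
    -- no oscillatory integral need be estimated.
    have h := intervalIntegral.sub_le_integral_of_hasDeriv_right_of_le hat
      (g := fun r => c * (Real.log r / 2 + (1 - Real.sin (4 * Real.pi * t * r)) * r⁻¹ /
        (8 * Real.pi * t) - E * t * (r ^ 3 / 3)))
      (g' := fun r => c * (r⁻¹ / 2 + (-(Real.cos (4 * Real.pi * t * r) * (4 * Real.pi * t)) * r⁻¹ +
        (1 - Real.sin (4 * Real.pi * t * r)) * (-(r ^ 2)⁻¹)) / (8 * Real.pi * t) - E * t * r ^ 2))
      ?_ (fun r hr => HasDerivAt.hasDerivWithinAt ?_)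
      (integrableOn_radialDensity 2 ht0.le ha0.le _) fun r hr => ?_
    · refine le_trans ?_ h
      have hlogτ : Real.log τ = -(Real.log t / 2) := by
        rw [hτd, Real.log_inv, Real.log_sqrt ht0.le]
      have hs1 : 0 ≤ (1 - Real.sin (4 * Real.pi * t * τ)) * τ⁻¹ / (8 * Real.pi * t) := by
        have := Real.sin_le_one (4 * Real.pi * t * τ)
        have : 0 ≤ 1 - Real.sin (4 * Real.pi * t * τ) := by linarith
        positivity
      have hs2 : (1 - Real.sin (4 * Real.pi * t * t⁻¹)) * t⁻¹⁻¹ / (8 * Real.pi * t) ≤ 1 := by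
        rw [inv_inv, div_le_one (by positivity)]
        have := Real.neg_one_le_sin (4 * Real.pi * t * t⁻¹)
        nlinarith
      have hs3 : E * t * (τ ^ 3 / 3) ≤ E := by
        have : E * t * (τ ^ 3 / 3) = E * (t * τ ^ 2 * τ) / 3 := by ring
        rw [this, hτ2]
        nlinarith
      have hs4 : 0 ≤ E * t * (t⁻¹ ^ 3 / 3) := by positivity
      rw [← mul_sub, hlogτ, Real.log_inv, div_mul_eq_mul_div, mul_div_assoc]
      gcongr
      linarith
    · refine ContinuousOn.const_mul ?_ _
      have hne : ∀ r ∈ Icc t⁻¹ τ, r ≠ 0 := fun r hr => (ha0.trans_le hr.1).ne'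
      refine ContinuousOn.sub (ContinuousOn.add ?_ ?_) (by fun_prop)
      · exact (ContinuousOn.log continuousOn_id hne).div_const 2
      · exact (ContinuousOn.mul (by fun_prop) (continuousOn_id.inv₀ hne)).div_const _
    · have hr0 : r ≠ 0 := (ha0.trans hr.1).ne'
      have e1 := (Real.hasDerivAt_log hr0).div_const 2
      have e2 := ((((hasDerivAt_const_mul (x := r) (4 * Real.pi * t)).sin.const_sub 1).mul
        (hasDerivAt_inv hr0))).div_const (8 * Real.pi * t)
      have e3 := ((hasDerivAt_pow 3 r).div_const 3).const_mul (E * t)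
      refine (((e1.add e2).sub e3).const_mul c).congr_deriv ?_
      push_cast
      ring
    · have hr0 : 0 < r := ha0.trans hr.1
      have hkr := hk r ⟨hr0, hr.2⟩
      have hd : radialDensity 2 t r = (waveKernel (logRadial r) t ^ 2 * r ^ 2) * r⁻¹ := by
        rw [radialDensity]
        field_simp
        ring
      rw [hd]
      refine le_trans ?_ (mul_le_mul_of_nonneg_right hkr (inv_pos.2 hr0).le)
      refine le_trans (mul_le_mul_of_nonneg_left ?_ hc0.le) (mul_assoc c _ _).ge
      rw [hhalf]
      have hs : 0 ≤ (1 - Real.sin (4 * Real.pi * t * r)) * (r ^ 2)⁻¹ / (8 * Real.pi * t) := by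
        have := Real.sin_le_one (4 * Real.pi * t * r)
        have : 0 ≤ 1 - Real.sin (4 * Real.pi * t * r) := by linarith
        positivity
      have heq : r⁻¹ / 2 + (-((1 - 2 * Real.sin (2 * Real.pi * t * r) ^ 2) * (4 * Real.pi * t)) *
          r⁻¹ + (1 - Real.sin (4 * Real.pi * t * r)) * (-(r ^ 2)⁻¹)) / (8 * Real.pi * t) -
          E * t * r ^ 2 = (Real.sin (2 * Real.pi * t * r) ^ 2 - E * t * r ^ 3) * r⁻¹ -
          (1 - Real.sin (4 * Real.pi * t * r)) * (r ^ 2)⁻¹ / (8 * Real.pi * t) := by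
        field_simp
        ring
      linarith
  -- On `[τ/2, τ]` with `τ = t^(-1/2)`, the weight is at least `(τ/2)^m` and the mean of `sin²`
  -- contributes `τ/4`. The boundary sines and the phase error are together at most `(E + 1)τ² ≤
  -- τ/8`.
  · refine ⟨c / (8 * 2 ^ m), by positivity, fun ρ hρ => ?_⟩
    filter_upwards [eventually_gt_atTop 0, hsqrt.eventually_lt_const hρ,
      hsqrt.eventually_lt_const (show 0 < (2 * Real.pi)⁻¹ by positivity),
      hsqrt.eventually_lt_const (show 0 < (8 * (E + 1))⁻¹ by positivity)] with t ht0 h1 h2 h3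
    rw [rate_add_three_sq' m ht0.le]
    obtain ⟨τ, hτd⟩ : ∃ τ, τ = (√t)⁻¹ := ⟨_, rfl⟩
    rw [← hτd] at h1 h2 h3 ⊢
    obtain ⟨hτ0, hτ2, hk⟩ := hτ ht0 hτd h2
    have ha0 : 0 < τ / 2 := by positivity
    have hat : τ / 2 ≤ τ := by linarith
    refine le_trans ?_ (hmono ht0.le ha0.le hat h1.le)
    have h := intervalIntegral.sub_le_integral_of_hasDeriv_right_of_le hat
      (g := fun r => (τ / 2) ^ m * c * (r / 2 - Real.sin (4 * Real.pi * t * r) / (8 * Real.pi * t) -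
        E * t * τ ^ 3 * r))
      (g' := fun r => (τ / 2) ^ m * (c * (1 / 2 - Real.cos (4 * Real.pi * t * r) *
        (4 * Real.pi * t) / (8 * Real.pi * t) - E * t * τ ^ 3)))
      (by fun_prop) (fun r hr => HasDerivAt.hasDerivWithinAt ?_)
      (integrableOn_radialDensity (m + 3) ht0.le ha0.le _) fun r hr => ?_
    · refine le_trans ?_ h
      have hti : τ ^ 2 = t⁻¹ := eq_inv_of_mul_eq_one_right hτ2
      have hs : ∀ x : ℝ, |Real.sin x / (8 * Real.pi * t)| ≤ τ ^ 2 / 8 := fun x => by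
        rw [abs_div, abs_of_pos (by positivity : 0 < 8 * Real.pi * t), hti,
          div_le_iff₀ (by positivity)]
        have : t⁻¹ / 8 * (8 * Real.pi * t) = Real.pi := by field_simp
        rw [this]
        linarith [Real.abs_sin_le_one x]
      have hs1 := abs_le.1 (hs (4 * Real.pi * t * τ))
      have hs2 := abs_le.1 (hs (4 * Real.pi * t * (τ / 2)))
      have hs3 : E * t * τ ^ 3 * τ = E * τ ^ 2 := by
        rw [show E * t * τ ^ 3 * τ = E * (t * τ ^ 2) * τ ^ 2 by ring, hτ2, mul_one]
      have hs4 : (E + 1) * τ ^ 2 ≤ τ / 8 := by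
        have := mul_le_mul_of_nonneg_left h3.le (by positivity : 0 ≤ 8 * (E + 1))
        rw [mul_inv_cancel₀ (by positivity)] at this
        nlinarith
      rw [← mul_sub]
      have : c / (8 * 2 ^ m) * τ ^ (m + 1) = (τ / 2) ^ m * c * (τ / 8) := by
        rw [div_pow, pow_succ]
        field_simp
      rw [this]
      gcongr
      have := sq_nonneg τ
      linarith [hs1.1, hs1.2, hs2.1, hs2.2]
    · have e1 := (hasDerivAt_id r).div_const 2
      have e2 := ((hasDerivAt_const_mul (x := r) (4 * Real.pi * t)).sin).div_const (8 * Real.pi * t)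
      have e3 := hasDerivAt_const_mul (x := r) (E * t * τ ^ 3)
      exact (((e1.sub e2).sub e3).const_mul ((τ / 2) ^ m * c)).congr_deriv (by ring)
    · have hr0 : 0 < r := ha0.trans hr.1
      have hkr := hk r ⟨hr0, hr.2⟩
      have hd : radialDensity (m + 3) t r = r ^ m * (waveKernel (logRadial r) t ^ 2 * r ^ 2) := by
        rw [radialDensity, show m + 3 - 1 = m + 2 by omega]
        ring
      rw [hd, hhalf]
      have hp : (τ / 2) ^ m ≤ r ^ m := pow_le_pow_left₀ ha0.le hr.1.le m
      refine le_trans ?_ (mul_le_mul_of_nonneg_right hp (by positivity))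
      refine mul_le_mul_of_nonneg_left (le_trans ?_ hkr) (by positivity)
      refine mul_le_mul_of_nonneg_left ?_ hc0.le
      have h5 : E * t * r ^ 3 ≤ E * t * τ ^ 3 := by
        have := pow_le_pow_left₀ hr0.le hr.2.le 3
        gcongr
      have h6 : (1 - 2 * Real.sin (2 * Real.pi * t * r) ^ 2) * (4 * Real.pi * t) /
          (8 * Real.pi * t) = 1 / 2 - Real.sin (2 * Real.pi * t * r) ^ 2 := by
        field_simp
        ring
      rw [h6]
      linarith

/-! ### From radial integrals to `L²` norms of the solution. -/

section Decay

variable {n : ℕ}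

/-- The surface area of the unit sphere of `ℝⁿ`. -/
def sphereArea (n : ℕ) : ℝ := n * (volume : Measure (Space n)).real (Metric.ball 0 1)

theorem sphereArea_pos (hn : 1 ≤ n) : 0 < sphereArea n := by
  have h : 0 < (volume : Measure (Space n)).real (Metric.ball 0 1) :=
    ENNReal.toReal_pos (Metric.measure_ball_pos volume _ one_pos).ne' measure_ball_lt_top.ne
  have : (0 : ℝ) < n := by exact_mod_cast hn
  exact mul_pos this h

theorem setIntegral_ball_waveKernel_sq (hn : 1 ≤ n) (t : ℝ) {δ : ℝ} (hδ : 0 ≤ δ) :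
    ∫ ξ in Metric.ball (0 : Space n) δ, waveKernel (logSymbol ξ) t ^ 2 =
      sphereArea n * ∫ r in (0 : ℝ)..δ, radialDensity n t r := by
  have : Nonempty (Fin n) := ⟨⟨0, hn⟩⟩
  let F : ℝ → ℝ := (Iio δ).indicator fun r => waveKernel (logRadial r) t ^ 2
  have h1 : ∫ ξ in Metric.ball (0 : Space n) δ, waveKernel (logSymbol ξ) t ^ 2 =
      ∫ ξ : Space n, F ‖ξ‖ := by
    rw [← integral_indicator measurableSet_ball]
    refine integral_congr_ae (Eventually.of_forall fun ξ => ?_)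
    simp [F, indicator, logSymbol_eq]
  rw [h1, integral_fun_norm_addHaar, finrank_euclideanSpace_fin, nsmul_eq_mul, smul_eq_mul,
    sphereArea, mul_assoc, intervalIntegral.integral_of_le hδ, integral_Ioc_eq_integral_Ioo]
  congr 2
  rw [← integral_indicator measurableSet_Ioo, ← integral_indicator measurableSet_Ioi]
  congr 1
  funext r
  by_cases h0 : 0 < r <;> by_cases h2 : r < δ <;>
    simp [F, indicator, h0, h2, radialDensity]

theorem norm_waveSol_sq (u₁ : L2 n) {t : ℝ} (ht : 0 ≤ t) :
    ‖waveSol u₁ t‖ ^ 2 = ∫ ξ, waveKernel (logSymbol ξ) t ^ 2 * ‖fourierL2 n u₁ ξ‖ ^ 2 := by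
  rw [← (fourierL2 n).norm_map, norm_sq_eq_integral]
  refine integral_congr_ae ?_
  filter_upwards [coeFn_fourierL2_waveSol u₁ ht] with ξ hξ
  rw [hξ, norm_mul, Complex.norm_real, mul_pow, Real.norm_eq_abs, sq_abs]

theorem integrable_waveKernel_sq_mul (u₁ : L2 n) {t : ℝ} (ht : 0 ≤ t) :
    Integrable fun ξ => waveKernel (logSymbol ξ) t ^ 2 * ‖fourierL2 n u₁ ξ‖ ^ 2 := by
  refine (integrable_norm_sq (fourierL2 n (waveSol u₁ t))).congr ?_
  filter_upwards [coeFn_fourierL2_waveSol u₁ ht] with ξ hξ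
  rw [hξ, norm_mul, Complex.norm_real, mul_pow, Real.norm_eq_abs, sq_abs]

theorem integrableOn_ball_waveKernel_sq (n : ℕ) {t : ℝ} (ht : 0 ≤ t) (δ : ℝ) :
    IntegrableOn (fun ξ : Space n => waveKernel (logSymbol ξ) t ^ 2) (Metric.ball 0 δ) := by
  refine IntegrableOn.of_bound measure_ball_lt_top ?_ (t ^ 2) (Eventually.of_forall fun ξ => ?_)
  · exact ((measurable_comp_logSymbol measurable_waveKernel t).pow_const 2).aestronglyMeasurable
  · rw [Real.norm_eq_abs, abs_of_nonneg (sq_nonneg _)]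
    exact waveKernel_sq_le_sq (logSymbol_nonneg ξ) ht

theorem rate_nonneg (n : ℕ) {t : ℝ} (ht : 0 ≤ t) : 0 ≤ rate n t := by
  unfold rate
  split_ifs <;> positivity

theorem eventually_rpow_le_rate_sq (hn : 1 ≤ n) :
    ∀ᶠ t : ℝ in atTop, t ^ (-(n : ℝ)) ≤ rate n t ^ 2 := by
  obtain rfl | rfl | ⟨m, rfl⟩ := eq_one_or_eq_two_or_exists_eq_add_three hn
  · filter_upwards [eventually_ge_atTop 1] with t ht
    rw [rate_one_sq (by linarith)]
    exact (Real.rpow_le_one_of_one_le_of_nonpos ht (by norm_num)).trans ht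
  · filter_upwards [eventually_ge_atTop 1, Real.tendsto_log_atTop.eventually_ge_atTop 1] with t ht h
    rw [rate_two_sq ht]
    exact (Real.rpow_le_one_of_one_le_of_nonpos ht (by norm_num)).trans h
  · filter_upwards [eventually_ge_atTop 1] with t ht
    rw [rate_add_three_sq m (by linarith)]
    refine Real.rpow_le_rpow_of_exponent_le ht ?_
    push_cast
    linarith [(Nat.cast_nonneg m : (0 : ℝ) ≤ m)]

/-- Makes the high-frequency contribution negligible in every dimension, through the crude
comparison with `t^(-n)`. -/
theorem eventually_sq_mul_exp_le_rate_sq (hn : 1 ≤ n) {c : ℝ} (hc : 0 < c) :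
    ∀ᶠ t : ℝ in atTop, t ^ 2 * Real.exp (-c * t) ≤ rate n t ^ 2 := by
  filter_upwards [eventually_rpow_le_rate_sq hn, eventually_gt_atTop 0,
    (tendsto_rpow_mul_exp_neg_mul_atTop_nhds_zero (2 + n) c hc).eventually_le_const one_pos]
    with t h1 h2 h3
  refine le_trans ?_ h1
  rw [Real.rpow_add h2, Real.rpow_two] at h3
  rw [Real.rpow_neg h2.le, ← one_div, le_div_iff₀ (Real.rpow_pos_of_pos h2 _)]
  linarith

theorem integral_norm_le_I0 {u₁ : L2 n} (hu : MemL11 u₁) : ∫ x, ‖u₁ x‖ ≤ I0 u₁ := by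
  refine le_trans (integral_mono hu.1.norm hu.2 fun x => ?_) (le_add_of_nonneg_left (norm_nonneg _))
  exact le_mul_of_one_le_left (norm_nonneg _) (le_add_of_nonneg_right (norm_nonneg x))

theorem norm_le_I0 (u₁ : L2 n) : ‖u₁‖ ≤ I0 u₁ :=
  le_add_of_nonneg_right (integral_nonneg fun x => by positivity)

/-- The frequencies are split at `2π|ξ| = 1`, where the symbol equals `log 2`. Below, `|û₁|` is
bounded by the `L¹` norm; above, Plancherel is used with the exponentially small kernel. -/
theorem exists_norm_waveSol_le (hn : 1 ≤ n) :
    ∃ A : ℝ, 0 < A ∧ ∃ T : ℝ, ∀ u₁ : L2 n, MemL11 u₁ → ∀ t, T ≤ t →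
      ‖waveSol u₁ t‖ ≤ A * I0 u₁ * rate n t := by
  obtain ⟨A, hA⟩ := exists_radial_upper hn
  have hlog : 0 < Real.log 2 := Real.log_pos one_lt_two
  obtain ⟨T, hT⟩ := eventually_atTop.1
    (hA.and ((eventually_sq_mul_exp_le_rate_sq hn hlog).and (eventually_ge_atTop 0)))
  have hS := sphereArea_pos hn
  refine ⟨√(sphereArea n * |A| + 1), by positivity, T, fun u₁ hu t ht => ?_⟩
  obtain ⟨h1, h2, ht0⟩ := hT t ht
  set δ := (2 * Real.pi)⁻¹ with hδ
  have hδ0 : 0 ≤ δ := by positivity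
  have hI : 0 ≤ I0 u₁ := (norm_nonneg _).trans (norm_le_I0 u₁)
  have hlow : ∫ ξ in Metric.ball (0 : Space n) δ,
      waveKernel (logSymbol ξ) t ^ 2 * ‖fourierL2 n u₁ ξ‖ ^ 2 ≤
      sphereArea n * |A| * I0 u₁ ^ 2 * rate n t ^ 2 := by
    calc _ ≤ ∫ ξ in Metric.ball (0 : Space n) δ, waveKernel (logSymbol ξ) t ^ 2 * I0 u₁ ^ 2 := by
          refine integral_mono_ae (integrable_waveKernel_sq_mul u₁ ht0).integrableOn
            ((integrableOn_ball_waveKernel_sq n ht0 δ).mul_const _) (ae_restrict_of_ae ?_)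
          filter_upwards [fourierL2_ae_eq_fourier hu.1] with ξ hξ
          rw [hξ]
          have := (norm_fourier_le_integral_norm u₁ ξ).trans (integral_norm_le_I0 hu)
          gcongr
      _ = sphereArea n * (∫ r in (0 : ℝ)..δ, radialDensity n t r) * I0 u₁ ^ 2 := by
          rw [integral_mul_const, setIntegral_ball_waveKernel_sq hn t hδ0]
      _ ≤ sphereArea n * (|A| * rate n t ^ 2) * I0 u₁ ^ 2 := by
          gcongr
          exact h1.trans (mul_le_mul_of_nonneg_right (le_abs_self A) (sq_nonneg _))
      _ = _ := by ring
  have hhigh : ∫ ξ in (Metric.ball (0 : Space n) δ)ᶜ,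
      waveKernel (logSymbol ξ) t ^ 2 * ‖fourierL2 n u₁ ξ‖ ^ 2 ≤ I0 u₁ ^ 2 * rate n t ^ 2 := by
    calc _ ≤ ∫ ξ in (Metric.ball (0 : Space n) δ)ᶜ, rate n t ^ 2 * ‖fourierL2 n u₁ ξ‖ ^ 2 := by
          refine setIntegral_mono_on (integrable_waveKernel_sq_mul u₁ ht0).integrableOn
            ((integrable_norm_sq _).const_mul _).integrableOn measurableSet_ball.compl
            fun ξ hξ => ?_
          have hξ' : δ ≤ ‖ξ‖ := by simpa using hξ
          have h1ξ : 1 ≤ 2 * Real.pi * ‖ξ‖ := by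
            have := mul_le_mul_of_nonneg_left hξ' (by positivity : 0 ≤ 2 * Real.pi)
            rwa [hδ, mul_inv_cancel₀ (by positivity)] at this
          have hl : Real.log 2 ≤ logSymbol ξ := by
            refine Real.log_le_log two_pos ?_
            nlinarith
          have hk := abs_waveKernel_le_exp (b := Real.log 2 / 2) (logSymbol_nonneg ξ) ht0
            (by linarith [Real.log_two_lt_d9]) (by linarith)
          refine mul_le_mul_of_nonneg_right (le_trans ?_ h2) (sq_nonneg _)
          rw [← sq_abs]
          refine (pow_le_pow_left₀ (abs_nonneg _) hk 2).trans (le_of_eq ?_)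
          rw [mul_pow, ← Real.exp_nat_mul]
          congr 2
          push_cast
          ring
      _ ≤ ∫ ξ, rate n t ^ 2 * ‖fourierL2 n u₁ ξ‖ ^ 2 :=
          setIntegral_le_integral ((integrable_norm_sq _).const_mul _)
            (Eventually.of_forall fun ξ => by positivity)
      _ = rate n t ^ 2 * ‖u₁‖ ^ 2 := by
          rw [integral_const_mul, ← norm_sq_eq_integral, (fourierL2 n).norm_map]
      _ ≤ _ := by
          rw [mul_comm]
          have := norm_le_I0 u₁
          gcongr
  have hsum : ‖waveSol u₁ t‖ ^ 2 ≤ (√(sphereArea n * |A| + 1) * I0 u₁ * rate n t) ^ 2 := by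
    rw [norm_waveSol_sq u₁ ht0, ← integral_add_compl measurableSet_ball
      (integrable_waveKernel_sq_mul u₁ ht0), mul_pow, mul_pow, Real.sq_sqrt (by positivity)]
    linarith
  exact le_of_sq_le_sq hsum (mul_nonneg (by positivity) (rate_nonneg n ht0))

theorem exists_le_norm_waveSol (hn : 1 ≤ n) :
    ∃ B : ℝ, 0 < B ∧ ∀ u₁ : L2 n, MemL11 u₁ → ∃ T : ℝ, ∀ t, T ≤ t →
      B * ‖P1 u₁‖ * rate n t ≤ ‖waveSol u₁ t‖ := by
  obtain ⟨B, hB, hlow⟩ := exists_radial_lower hn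
  have hS := sphereArea_pos hn
  refine ⟨√(sphereArea n * B) / 2, by positivity, fun u₁ hu => ?_⟩
  rcases eq_or_ne (P1 u₁) 0 with hP | hP
  · exact ⟨0, fun t _ => by simp [hP]⟩
  have hP0 : 0 < ‖P1 u₁‖ := norm_pos_iff.2 hP
  -- The radius depends on the modulus of continuity of `û₁` at 0, hence so does the final time.
  obtain ⟨ρ, hρ, hball⟩ : ∃ ρ > 0, ∀ ξ ∈ Metric.ball (0 : Space n) ρ,
      ‖P1 u₁‖ / 2 < ‖𝓕 (u₁ : Space n → ℂ) ξ‖ := by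
    refine Metric.eventually_nhds_iff_ball.1 ?_
    refine (continuous_fourier_of_integrable hu.1).norm.continuousAt.eventually_const_lt ?_
    change _ < ‖𝓕 (u₁ : Space n → ℂ) 0‖
    rw [fourier_zero_eq_integral]
    exact half_lt_self hP0
  obtain ⟨T, hT⟩ := eventually_atTop.1 ((hlow ρ hρ).and (eventually_ge_atTop 0))
  refine ⟨T, fun t ht => ?_⟩
  obtain ⟨h1, ht0⟩ := hT t ht
  refine le_of_sq_le_sq ?_ (norm_nonneg _)
  rw [norm_waveSol_sq u₁ ht0]
  calc (√(sphereArea n * B) / 2 * ‖P1 u₁‖ * rate n t) ^ 2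
      = sphereArea n * (B * rate n t ^ 2) * (‖P1 u₁‖ / 2) ^ 2 := by
        rw [mul_pow, mul_pow, div_pow, Real.sq_sqrt (by positivity)]
        ring
    _ ≤ sphereArea n * (∫ r in (0 : ℝ)..ρ, radialDensity n t r) * (‖P1 u₁‖ / 2) ^ 2 := by gcongr
    _ = ∫ ξ in Metric.ball (0 : Space n) ρ,
          waveKernel (logSymbol ξ) t ^ 2 * (‖P1 u₁‖ / 2) ^ 2 := by
        rw [integral_mul_const, setIntegral_ball_waveKernel_sq hn t hρ.le]
    _ ≤ ∫ ξ in Metric.ball (0 : Space n) ρ,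
          waveKernel (logSymbol ξ) t ^ 2 * ‖fourierL2 n u₁ ξ‖ ^ 2 := by
        refine integral_mono_ae ((integrableOn_ball_waveKernel_sq n ht0 ρ).mul_const _)
          (integrable_waveKernel_sq_mul u₁ ht0).integrableOn ?_
        filter_upwards [ae_restrict_of_ae (fourierL2_ae_eq_fourier hu.1),
          ae_restrict_mem measurableSet_ball] with ξ hξ hmem
        rw [hξ]
        have := (hball ξ hmem).le
        gcongr
    _ ≤ _ := setIntegral_le_integral (integrable_waveKernel_sq_mul u₁ ht0)
        (Eventually.of_forall fun ξ => by positivity)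

end Decay

end

end LogWave

/-! ### Assembly of existence, uniqueness and the two bounds. -/

theorem theorem1p2 (n : ℕ) (hn : 1 ≤ n) :
    ∃ C : ℝ, 0 < C ∧ ∃ T₀ : ℝ, ∀ u₁ : LogWave.L2 n, LogWave.MemL11 u₁ →
      ∃ u : ℝ → LogWave.L2 n,
        LogWave.IsMildSolution 0 u₁ u ∧
        (∀ v : ℝ → LogWave.L2 n, LogWave.IsMildSolution 0 u₁ v → ∀ t, 0 ≤ t → v t = u t) ∧
        (∀ t, T₀ ≤ t → ‖u t‖ ≤ C⁻¹ * LogWave.I0 u₁ * LogWave.rate n t) ∧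
        (∃ T : ℝ, ∀ t, T ≤ t → C * ‖LogWave.P1 u₁‖ * LogWave.rate n t ≤ ‖u t‖) := by
  obtain ⟨A, hA, T₀, hupper⟩ := LogWave.exists_norm_waveSol_le hn
  obtain ⟨B, hB, hlower⟩ := LogWave.exists_le_norm_waveSol hn
  have hC : 0 < min A⁻¹ B := lt_min (inv_pos.2 hA) hB
  -- One constant must serve both bounds. Times are taken nonnegative so that the rate is
  -- nonnegative and changing the constant preserves the inequalities.
  refine ⟨min A⁻¹ B, hC, max T₀ 0, fun u₁ hu => ⟨LogWave.waveSol u₁,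
    LogWave.isMildSolution_waveSol u₁,
    fun v hv t ht => hv.unique hn (LogWave.isMildSolution_waveSol u₁) ht, fun t ht => ?_, ?_⟩⟩
  · refine (hupper u₁ hu t ((le_max_left _ _).trans ht)).trans ?_
    have h1 : A ≤ (min A⁻¹ B)⁻¹ := (le_inv_comm₀ hA hC).2 (min_le_left _ _)
    have h2 := LogWave.rate_nonneg n ((le_max_right _ _).trans ht)
    have h3 := (norm_nonneg _).trans (LogWave.norm_le_I0 u₁)
    gcongr
  · obtain ⟨T, hT⟩ := hlower u₁ hu
    refine ⟨max T 0, fun t ht => le_trans ?_ (hT t ((le_max_left _ _).trans ht))⟩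
    have h2 := LogWave.rate_nonneg n ((le_max_right _ _).trans ht)
    have h3 := min_le_right A⁻¹ B
    gcongr
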